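/- Let $\gamma_d(dx)=\pi^{-d/2}e^{-|x|^2}dx$ on $\mathbb R^d$, let $L=\frac12\Delta-\langle x,\nabla\rangle$, and let $h_\nu(x)=(2^{|\nu|}\nu!)^{-1/2}\prod_{i=1}^d(-1)^{\nu_i}e^{x_i^2}\partial_{x_i}^{\nu_i}e^{-x_i^2}$, $\nu\in\mathbb N_0^d$, be the normalized Hermite polynomials, so that $Lh_\nu=-|\nu|h_\nu$. Let $$T_tf(x)=\int_{\mathbb R^d} f\big(\sqrt{1-e^{-2t}}\,u+e^{-t}x\big)\,\gamma_d(du),\qquad P_tf(x)=\frac1{\sqrt\pi}\int_0^\infty\frac{e^{-u}}{\sqrt u}\,T_{t^2/(4u)}f(x)\,du$$ be the Ornstein–Uhlenbeck and Poisson–Hermite semigroups. For $\alpha>0$, $k$ the smallest integer greater than $\alpha$, $1\le p<\infty$ and $1\le q\le\infty$, the Gaussian Besov–Lipschitz space $B^\alpha_{p,q}(\gamma_d)$ is the set of (real-valued) $f\in L^p(\gamma_d)$ for which $$\|f\|_{B^\alpha_{p,q}}=\|f\|_{p,\gamma_d}+\Big(\int_0^\infty\Big(t^{k-\alpha}\Big\|\frac{\partial^kP_tf}{\partial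 t^k}\Big\|_{p,\gamma_d}\Big)^q\frac{dt}t\Big)^{1/q}$$ is finite, where for $q=\infty$ the second term is replaced by the smallest constant $A$ such that $\|\partial_t^kP_tf\|_{p,\gamma_d}\le A\,t^{-k+\alpha}$ for all $t>0$. For $0<\beta<1$ the Gaussian Riesz fractional derivative is $$D^\beta f=\frac1{c_\beta}\int_0^\infty t^{-\beta-1}(P_tf-f)\,dt,\qquad c_\beta=\int_0^\infty u^{-\beta-1}(e^{-u}-1)\,du .$$ **Theorem.** Let $0<\beta<\alpha<1$, $1\le p<\infty$ and $1\le q\le\infty$. 1. On polynomials, $D^\beta=(-L)^{\beta/2}$: for every finite linear combination $f=\sum_\nu a_\nu h_\nu$ and every $x\in\mathbb R^d$ the integral defining $D^\beta f(x)$ converges absolutely and $D^\beta f(x)=\sum_\nu a_\nu|\nu|^{\beta/2}h_\nu(x)$. 2. For every $f\in B^\alpha_{p,q}(\gamma_d)$ the integral defining $D^\beta f(x)$ converges absolutely for $\gamma_d$-almost every $x$. 3. $D^\beta$ is bounded from $B^\alpha_{p,q}(\gamma_d)$ into $B^{\alpha-\beta}_{p,q}(\gamma_d)$: there is a constant $C$,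 independent of $f$, such that for every $f\in B^\alpha_{p,q}(\gamma_d)$ one has $D^\beta f\in B^{\alpha-\beta}_{p,q}(\gamma_d)$ and $\|D^\beta f\|_{B^{\alpha-\beta}_{p,q}}\le C\,\|f\|_{B^\alpha_{p,q}}$. -/

import Mathlib

open MeasureTheory Set
open scoped ENNReal NNReal Nat

noncomputable section

/-- The Gaussian measure `γ_d(dx) = π^{-d/2} e^{-|x|²} dx` on `ℝ^d`. -/
def gaussMeasure (d : ℕ) : Measure (EuclideanSpace ℝ (Fin d)) :=
  (volume : Measure (EuclideanSpace ℝ (Fin d))).withDensity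
    (fun x => ENNReal.ofReal (Real.exp (-‖x‖ ^ 2) / Real.pi ^ ((d : ℝ) / 2)))

/-- The normalized Hermite polynomial `h_ν` in `d` variables, by Rodrigues' formula. -/
def hermiteFun {d : ℕ} (ν : Fin d → ℕ) (x : EuclideanSpace ℝ (Fin d)) : ℝ :=
  1 / Real.sqrt ((2 : ℝ) ^ (∑ i, ν i) * ((∏ i, (ν i)! : ℕ) : ℝ)) *
    ∏ i, ((-1 : ℝ) ^ (ν i) * Real.exp ((x i) ^ 2) *
      iteratedDeriv (ν i) (fun s : ℝ => Real.exp (-s ^ 2)) (x i))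

/-- The Ornstein–Uhlenbeck semigroup `T_t`, `t ≥ 0`, in Mehler's form
`T_t f(x) = ∫ f(√(1 - e^{-2t}) u + e^{-t} x) γ_d(du)`. -/
def ouSemigroup {d : ℕ} (t : ℝ) (f : EuclideanSpace ℝ (Fin d) → ℝ)
    (x : EuclideanSpace ℝ (Fin d)) : ℝ :=
  ∫ u, f (Real.sqrt (1 - Real.exp (-2 * t)) • u + Real.exp (-t) • x) ∂(gaussMeasure d)

/-- The Poisson–Hermite semigroup `P_t`, by Bochner subordination:
`P_t f(x) = π^{-1/2} ∫_0^∞ e^{-u} u^{-1/2} T_{t²/(4u)} f(x) du`. -/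
def poissonHermite {d : ℕ} (t : ℝ) (f : EuclideanSpace ℝ (Fin d) → ℝ)
    (x : EuclideanSpace ℝ (Fin d)) : ℝ :=
  1 / Real.sqrt Real.pi *
    ∫ u in Ioi (0 : ℝ), Real.exp (-u) / Real.sqrt u * ouSemigroup (t ^ 2 / (4 * u)) f x

/-- The `L^p(γ_d)` norm of `∂^k P_t f / ∂t^k`, as a function of `t`. -/
def poissonDerivNorm {d : ℕ} (k : ℕ) (p : ℝ≥0∞) (f : EuclideanSpace ℝ (Fin d) → ℝ)
    (t : ℝ) : ℝ≥0∞ :=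
  eLpNorm (fun x => iteratedDeriv k (fun s : ℝ => poissonHermite s f x) t) p (gaussMeasure d)

/-- The smallest integer strictly greater than `α` (for `α ≥ 0`). -/
def besovOrder (α : ℝ) : ℕ := ⌊α⌋₊ + 1

/-- The second term of the norm of `B^α_{p,q}(γ_d)`, with `k` the smallest integer `> α`.
For `q < ∞` it is `(∫_0^∞ (t^{k-α} ‖∂_t^k P_t f‖_p)^q dt/t)^{1/q}`; for `q = ∞` it is the smallest
`A` with `‖∂_t^k P_t f‖_p ≤ A t^{-k+α}` for all `t > 0`. -/
def besovSeminorm {d : ℕ} (α : ℝ) (p q : ℝ≥0∞) (f : EuclideanSpace ℝ (Fin d) → ℝ) : ℝ≥0∞ :=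
  if q = ∞ then
    sInf {A : ℝ≥0∞ | ∀ t : ℝ, 0 < t →
      poissonDerivNorm (besovOrder α) p f t ≤ A * ENNReal.ofReal (t ^ (-(besovOrder α : ℝ) + α))}
  else
    (∫⁻ t in Ioi (0 : ℝ),
      (ENNReal.ofReal (t ^ ((besovOrder α : ℝ) - α)) *
        poissonDerivNorm (besovOrder α) p f t) ^ q.toReal * ENNReal.ofReal (1 / t))
      ^ (1 / q.toReal)

/-- The norm of the Gaussian Besov–Lipschitz space `B^α_{p,q}(γ_d)` (possibly `∞`). -/
def besovNorm {d : ℕ} (α : ℝ) (p q : ℝ≥0∞) (f : EuclideanSpace ℝ (Fin d) → ℝ) : ℝ≥0∞ :=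
  eLpNorm f p (gaussMeasure d) + besovSeminorm α p q f

/-- `f` belongs to the Gaussian Besov–Lipschitz space `B^α_{p,q}(γ_d)`. -/
def MemBesov {d : ℕ} (α : ℝ) (p q : ℝ≥0∞) (f : EuclideanSpace ℝ (Fin d) → ℝ) : Prop :=
  MemLp f p (gaussMeasure d) ∧ besovSeminorm α p q f < ∞

/-- The constant `c_β = ∫_0^∞ u^{-β-1} (e^{-u} - 1) du`, for `0 < β < 1`. -/
def rieszConst (β : ℝ) : ℝ :=
  ∫ u in Ioi (0 : ℝ), u ^ (-β - 1) * (Real.exp (-u) - 1)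

/-- The integrand `t^{-β-1} (P_t f(x) - f(x))` of the Riesz fractional derivative. -/
def rieszIntegrand {d : ℕ} (β : ℝ) (f : EuclideanSpace ℝ (Fin d) → ℝ)
    (x : EuclideanSpace ℝ (Fin d)) (t : ℝ) : ℝ :=
  t ^ (-β - 1) * (poissonHermite t f x - f x)

/-- The Gaussian Riesz fractional derivative of order `0 < β < 1`,
`D^β f(x) = c_β⁻¹ ∫_0^∞ t^{-β-1} (P_t f(x) - f(x)) dt`. -/
def rieszDeriv {d : ℕ} (β : ℝ) (f : EuclideanSpace ℝ (Fin d) → ℝ)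
    (x : EuclideanSpace ℝ (Fin d)) : ℝ :=
  1 / rieszConst β * ∫ t in Ioi (0 : ℝ), rieszIntegrand β f x t

/-- The polynomial `∑_ν a_ν h_ν` with finitely many non-zero coefficients. -/
def hermiteSum {d : ℕ} (a : (Fin d → ℕ) →₀ ℝ) (x : EuclideanSpace ℝ (Fin d)) : ℝ :=
  a.sum fun ν c => c * hermiteFun ν x

/-- The spectral operator `(-L)^{β/2}` on polynomials: `∑_ν a_ν h_ν ↦ ∑_ν a_ν |ν|^{β/2} h_ν`. -/
def spectralRiesz {d : ℕ} (β : ℝ) (a : (Fin d → ℕ) →₀ ℝ) (x : EuclideanSpace ℝ (Fin d)) : ℝ :=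
  a.sum fun ν c => c * (((∑ i, ν i : ℕ) : ℝ) ^ (β / 2) * hermiteFun ν x)

end

section

open ProbabilityTheory Filter Topology

/-! Everything is read off the subordination formula `P_t = ∫ T_r μ_t(dr)`, where `μ_t`
(`subMeasure`) is the one-sided stable law of order 1/2, with Laplace transform `e^{-t√l}`. Mixtures
of Ornstein–Uhlenbeck kernels leave `γ_d` invariant and compose by convolving the mixing measures.
This gives contractivity on `L^p`, the semigroup law (from `μ_t * μ_s = μ_{t+s}`) and commutation.
Differentiating the density of `μ_t` in `t` writes `∂_t P_t` as the difference of two such mixtures,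
of masses at most `1/t` and `8/t`, so that `‖∂_t P_t f‖_p ≤ (9/t) ‖f‖_p`.

Since `α` and `α - β` lie in `(0,1)`, both Besov norms use the first derivative. As `‖∂_t P_t f‖_p`
is nonincreasing in `t`, the seminorm bounds it by `4 t^{α-1}` times itself; hence `‖P_t f - f‖_p =
O(t^α)`, and the Riesz integral converges absolutely in `L^p`. It is split at `t = 1`, with the
trivial bound `2‖f‖_p` at infinity.

The key estimate is `eLpNorm_poissonDeriv_rieszDeriv_le`. By Fubini, `∂_t P_t D^β f` is the integral
of `s^{-β-1} ∂_t P_t (P_s f - f)`, up to the factor `1/c_β`. Sharing `t` as `t/2 + t/2`, the last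
function equals `(P_{t/2+s} - P_{t/2}) g` with `g = ∂P_{t/2} f`, and its norm is at most `min(18
s/t, 2) ‖g‖_p`. Integrating in `s`, split at `s = t`, costs exactly a factor `t^{-β}`, which the
change of exponent from `α` to `α - β` absorbs; the shift from `t` to `t/2` is a change of
variables.

On polynomials, Mehler's formula gives `T_r h_ν = e^{-|ν| r} h_ν`, so `P_t h_ν = e^{-t√|ν|} h_ν`,
and scaling the integral that defines `c_β` produces `|ν|^{β/2}`. -/

/-! ### The Gaussian measure and its rotation property. -/

theorem measurable_gaussDensity (d : ℕ) : Measurable (fun x : EuclideanSpace ℝ (Fin d) =>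
    Real.exp (-‖x‖ ^ 2) / Real.pi ^ ((d : ℝ) / 2)) := by fun_prop

theorem gaussDensity_nonneg (d : ℕ) (x : EuclideanSpace ℝ (Fin d)) :
    0 ≤ Real.exp (-‖x‖ ^ 2) / Real.pi ^ ((d : ℝ) / 2) := by positivity

theorem integral_gaussMeasure {F : Type*} [NormedAddCommGroup F] [NormedSpace ℝ F] (d : ℕ)
    (f : EuclideanSpace ℝ (Fin d) → F) :
    ∫ x, f x ∂(gaussMeasure d) =
      ∫ x, (Real.exp (-‖x‖ ^ 2) / Real.pi ^ ((d : ℝ) / 2)) • f x := by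
  rw [gaussMeasure, integral_withDensity_eq_integral_toReal_smul₀
    (measurable_gaussDensity d).ennreal_ofReal.aemeasurable
    (Filter.Eventually.of_forall fun _ => ENNReal.ofReal_lt_top)]
  simp only [ENNReal.toReal_ofReal (gaussDensity_nonneg d _)]

instance isProbabilityMeasure_gaussMeasure (d : ℕ) : IsProbabilityMeasure (gaussMeasure d) := by
  have hI : ∫ x : EuclideanSpace ℝ (Fin d), Real.exp (-‖x‖ ^ 2) = Real.pi ^ ((d : ℝ) / 2) := by
    simpa using GaussianFourier.integral_rexp_neg_mul_sq_norm
      (V := EuclideanSpace ℝ (Fin d)) one_pos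
  have hpos : 0 < Real.pi ^ ((d : ℝ) / 2) := by positivity
  -- A non-integrable function would have Bochner integral 0, which is not `π^{d/2}`.
  have hint : Integrable (fun x : EuclideanSpace ℝ (Fin d) => Real.exp (-‖x‖ ^ 2)) := by
    by_contra h
    rw [integral_undef h] at hI
    exact hpos.ne hI
  constructor
  rw [gaussMeasure, withDensity_apply _ MeasurableSet.univ, Measure.restrict_univ,
    ← ofReal_integral_eq_lintegral_ofReal (hint.div_const _)
      (Filter.Eventually.of_forall (gaussDensity_nonneg d)), integral_div, hI, div_self hpos.ne',
    ENNReal.ofReal_one]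

theorem charFun_gaussMeasure (d : ℕ) (w : EuclideanSpace ℝ (Fin d)) :
    charFun (gaussMeasure d) w = Complex.exp (-(‖w‖ : ℂ) ^ 2 / 4) := by
  have h := GaussianFourier.integral_cexp_neg_mul_sq_norm_add (V := EuclideanSpace ℝ (Fin d))
    (b := 1) (by simp) Complex.I w
  have hpi : ((Real.pi : ℂ)) ^ ((d : ℂ) / 2) = ((Real.pi ^ ((d : ℝ) / 2) : ℝ) : ℂ) := by
    rw [Complex.ofReal_cpow Real.pi_pos.le]; simp
  have hne : ((Real.pi ^ ((d : ℝ) / 2) : ℝ) : ℂ) ≠ 0 := by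
    exact_mod_cast (by positivity : Real.pi ^ ((d : ℝ) / 2) ≠ 0)
  rw [charFun_apply, integral_gaussMeasure]
  have : ∀ x : EuclideanSpace ℝ (Fin d), (Real.exp (-‖x‖ ^ 2) / Real.pi ^ ((d : ℝ) / 2)) •
      Complex.exp ((inner ℝ x w : ℝ) * Complex.I) =
      (((Real.pi ^ ((d : ℝ) / 2) : ℝ) : ℂ))⁻¹ * Complex.exp (-1 * (‖x‖ : ℂ) ^ 2 +
        Complex.I * (inner ℝ w x : ℝ)) := by
    intro x
    rw [Complex.exp_add, Complex.real_smul, real_inner_comm]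
    push_cast
    rw [mul_comm Complex.I]
    field_simp
  simp_rw [this]
  rw [integral_const_mul, h]
  simp only [finrank_euclideanSpace, Fintype.card_fin, div_one]
  rw [hpi, inv_mul_cancel_left₀ hne]
  simp

/-- A linear combination of independent Gaussian vectors is a scaled Gaussian vector. -/
theorem map_prod_gaussMeasure (d : ℕ) {a b c : ℝ} (h : a ^ 2 + b ^ 2 = c ^ 2) :
    ((gaussMeasure d).prod (gaussMeasure d)).map (fun z => a • z.1 + b • z.2) =
      (gaussMeasure d).map (fun u => c • u) := by
  have e : (fun z : EuclideanSpace ℝ (Fin d) × EuclideanSpace ℝ (Fin d) => a • z.1 + b • z.2) =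
      (fun z => z.1 + z.2) ∘ Prod.map (fun u => a • u) (fun u => b • u) := rfl
  have hm : ∀ c : ℝ, Measurable (fun u : EuclideanSpace ℝ (Fin d) => c • u) := fun c => by fun_prop
  have : ∀ c : ℝ, IsProbabilityMeasure ((gaussMeasure d).map (fun u => c • u)) := fun c =>
    Measure.isProbabilityMeasure_map (hm c).aemeasurable
  rw [e, ← Measure.map_map (by fun_prop) (by fun_prop), ← Measure.map_prod_map _ _ (hm a) (hm b)]
  apply Measure.ext_of_charFun
  rw [charFun_map_add_prod_eq_mul]
  ext w
  rw [Pi.mul_apply]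
  erw [charFun_map_smul, charFun_map_smul, charFun_map_smul]
  rw [charFun_gaussMeasure, charFun_gaussMeasure, charFun_gaussMeasure, ← Complex.exp_add]
  congr 1
  simp only [norm_smul, Real.norm_eq_abs]
  push_cast
  have h1 : ∀ t : ℝ, ((|t| : ℝ) : ℂ) ^ 2 = (t : ℂ) ^ 2 := fun t => by
    rw [← Complex.ofReal_pow, sq_abs, Complex.ofReal_pow]
  have h2 : (a : ℂ) ^ 2 + (b : ℂ) ^ 2 = (c : ℂ) ^ 2 := by exact_mod_cast h
  simp only [mul_pow, h1]
  rw [← h2]; ring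

theorem lintegral_lintegral_gaussMeasure (d : ℕ) {a b c : ℝ} (h : a ^ 2 + b ^ 2 = c ^ 2)
    {g : EuclideanSpace ℝ (Fin d) → ℝ≥0∞} (hg : Measurable g) :
    ∫⁻ u, ∫⁻ v, g (a • u + b • v) ∂(gaussMeasure d) ∂(gaussMeasure d) =
      ∫⁻ u, g (c • u) ∂(gaussMeasure d) := by
  have : ∫⁻ x, g x ∂_ = ∫⁻ x, g x ∂_ :=
    congrArg (fun μ => ∫⁻ x, g x ∂μ) (map_prod_gaussMeasure d h)
  rw [lintegral_map hg (by fun_prop), lintegral_map hg (by fun_prop),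
    lintegral_prod _ (by fun_prop)] at this
  exact this

/-! ### Mixtures of Ornstein–Uhlenbeck kernels. -/

/-- The standard deviation factor in Mehler's formula. -/
noncomputable def ouScale (r : ℝ) : ℝ := Real.sqrt (1 - Real.exp (-2 * r))

theorem ouScale_sq {r : ℝ} (hr : 0 ≤ r) : ouScale r ^ 2 = 1 - Real.exp (-2 * r) := by
  rw [ouScale, Real.sq_sqrt]
  rw [sub_nonneg, Real.exp_le_one_iff]; linarith

@[fun_prop]
theorem continuous_ouScale : Continuous ouScale := by unfold ouScale; fun_prop

@[fun_prop]
theorem measurable_ouScale : Measurable ouScale := continuous_ouScale.measurable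

/-- The mixture of Ornstein–Uhlenbeck transition kernels with mixing measure `ρ`. -/
noncomputable def mixKernel (d : ℕ) (ρ : Measure ℝ) [IsFiniteMeasure ρ] :
    Kernel (EuclideanSpace ℝ (Fin d)) (EuclideanSpace ℝ (Fin d)) :=
  (Kernel.id ×ₖ Kernel.const _ (ρ.prod (gaussMeasure d))).map
    (fun z => ouScale z.2.1 • z.2.2 + Real.exp (-z.2.1) • z.1)

theorem mixKernel_apply (d : ℕ) (ρ : Measure ℝ) [IsFiniteMeasure ρ]
    (x : EuclideanSpace ℝ (Fin d)) :
    mixKernel d ρ x = (ρ.prod (gaussMeasure d)).map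
      (fun z => ouScale z.1 • z.2 + Real.exp (-z.1) • x) := by
  rw [mixKernel, Kernel.map_apply _ (by fun_prop), Kernel.prod_apply, Kernel.id_apply,
    Kernel.const_apply, Measure.dirac_prod, Measure.map_map (by fun_prop) (by fun_prop)]
  rfl

theorem mixKernel_univ (d : ℕ) (ρ : Measure ℝ) [IsFiniteMeasure ρ]
    (x : EuclideanSpace ℝ (Fin d)) : mixKernel d ρ x univ = ρ univ := by
  rw [mixKernel_apply, Measure.map_apply (by fun_prop) MeasurableSet.univ, preimage_univ,
    ← univ_prod_univ, Measure.prod_prod, measure_univ (μ := gaussMeasure d), mul_one]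

instance (d : ℕ) (ρ : Measure ℝ) [IsFiniteMeasure ρ] : IsFiniteKernel (mixKernel d ρ) :=
  ⟨ρ univ, measure_lt_top _ _, fun x => (mixKernel_univ d ρ x).le⟩

theorem lintegral_mixKernel {d : ℕ} (ρ : Measure ℝ) [IsFiniteMeasure ρ]
    (x : EuclideanSpace ℝ (Fin d)) {g : EuclideanSpace ℝ (Fin d) → ℝ≥0∞} (hg : Measurable g) :
    ∫⁻ y, g y ∂(mixKernel d ρ x) =
      ∫⁻ r, ∫⁻ u, g (ouScale r • u + Real.exp (-r) • x) ∂(gaussMeasure d) ∂ρ := by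
  rw [mixKernel_apply, lintegral_map hg (by fun_prop), lintegral_prod _ (by fun_prop)]

/-- Carries integrability and null sets at a fixed point `x` from one mixing measure to another that
it dominates, with no new exceptional set. -/
theorem mixKernel_mono (d : ℕ) {ρ σ : Measure ℝ} [IsFiniteMeasure ρ] [IsFiniteMeasure σ]
    {c : ℝ≥0∞} (h : ρ ≤ c • σ) (x : EuclideanSpace ℝ (Fin d)) :
    mixKernel d ρ x ≤ c • mixKernel d σ x := by
  refine Measure.le_iff.2 fun s hs => ?_
  have e : ∀ (τ : Measure ℝ) [IsFiniteMeasure τ], mixKernel d τ x s = ∫⁻ r, ∫⁻ u,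
      s.indicator 1 (ouScale r • u + Real.exp (-r) • x) ∂(gaussMeasure d) ∂τ := fun τ _ => by
    rw [← lintegral_mixKernel τ x (measurable_one.indicator hs), lintegral_indicator_one hs]
  rw [Measure.smul_apply, e, e, smul_eq_mul]
  refine (lintegral_mono' h le_rfl).trans ?_
  rw [lintegral_smul_measure, smul_eq_mul]

/-- The semigroup law of `T_r`, averaged over both times. Nonnegativity of the times is needed for
`ouScale_sq`. -/
theorem mixKernel_comp (d : ℕ) {ρ σ : Measure ℝ} [IsFiniteMeasure ρ] [IsFiniteMeasure σ]
    (hρ : ∀ᵐ r ∂ρ, 0 ≤ r) (hσ : ∀ᵐ r ∂σ, 0 ≤ r) :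
    mixKernel d σ ∘ₖ mixKernel d ρ = mixKernel d (ρ.conv σ) := by
  ext x s hs
  have hg : Measurable (s.indicator (1 : EuclideanSpace ℝ (Fin d) → ℝ≥0∞)) :=
    measurable_one.indicator hs
  rw [← lintegral_indicator_one hs, ← lintegral_indicator_one hs, Kernel.lintegral_comp _ _ _ hg]
  generalize s.indicator (1 : EuclideanSpace ℝ (Fin d) → ℝ≥0∞) = g at hg
  rw [lintegral_mixKernel _ _ hg, lintegral_mixKernel _ _ (hg.lintegral_kernel)]
  rw [Measure.lintegral_conv (by fun_prop)]
  refine lintegral_congr_ae ?_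
  filter_upwards [hρ] with r hr
  simp_rw [lintegral_mixKernel _ _ hg]
  rw [lintegral_lintegral_swap (by fun_prop)]
  refine lintegral_congr_ae ?_
  filter_upwards [hσ] with q hq
  -- The noise collected up to time `r` is damped by `e^{-q}` and added to independent noise of
  -- duration `q`; the variances add up to that of duration `r + q`.
  have key : (Real.exp (-q) * ouScale r) ^ 2 + (ouScale q) ^ 2 = (ouScale (r + q)) ^ 2 := by
    rw [mul_pow, ouScale_sq hr, ouScale_sq hq, ouScale_sq (add_nonneg hr hq), ← Real.exp_nat_mul,
      mul_sub, ← Real.exp_add]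
    ring_nf
  have := lintegral_lintegral_gaussMeasure d key
    (g := fun y => g (y + Real.exp (-(r + q)) • x)) (by fun_prop)
  rw [← this]
  refine lintegral_congr fun u => lintegral_congr fun v => congrArg g ?_
  rw [smul_add, smul_smul, smul_smul, ← Real.exp_add, add_comm (-q) (-r), ← neg_add]
  abel

/-- The Gaussian measure is invariant under the mixtures of Ornstein–Uhlenbeck kernels. -/
theorem mixKernel_comp_gaussMeasure (d : ℕ) {ρ : Measure ℝ} [IsFiniteMeasure ρ]
    (hρ : ∀ᵐ r ∂ρ, 0 ≤ r) :
    (gaussMeasure d).bind (mixKernel d ρ) = ρ univ • gaussMeasure d := by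
  ext s hs
  have hg : Measurable (s.indicator (1 : EuclideanSpace ℝ (Fin d) → ℝ≥0∞)) :=
    measurable_one.indicator hs
  rw [← lintegral_indicator_one hs,
    Measure.lintegral_bind (mixKernel d ρ).measurable.aemeasurable hg.aemeasurable,
    Measure.smul_apply, ← lintegral_indicator_one hs]
  generalize s.indicator (1 : EuclideanSpace ℝ (Fin d) → ℝ≥0∞) = g at hg
  simp_rw [lintegral_mixKernel _ _ hg]
  rw [lintegral_lintegral_swap (by fun_prop)]
  have : ∀ᵐ r ∂ρ, ∫⁻ x, ∫⁻ u, g (ouScale r • u + Real.exp (-r) • x) ∂(gaussMeasure d)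
      ∂(gaussMeasure d) = ∫⁻ u, g u ∂(gaussMeasure d) := by
    filter_upwards [hρ] with r hr
    have key : (ouScale r) ^ 2 + (Real.exp (-r)) ^ 2 = 1 ^ 2 := by
      rw [ouScale_sq hr, ← Real.exp_nat_mul]; ring_nf
    rw [lintegral_lintegral_swap (by fun_prop), lintegral_lintegral_gaussMeasure d key hg]
    simp
  rw [lintegral_congr_ae this, lintegral_const, mul_comm, smul_eq_mul]

/-! ### The stable density of order 1/2 and its Laplace transform. -/

/-- The primitive of `e^{-v²}` vanishing at the origin. -/
noncomputable def gaussPrimitive (x : ℝ) : ℝ := ∫ v in (0 : ℝ)..x, Real.exp (-v ^ 2)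

theorem hasDerivAt_gaussPrimitive (x : ℝ) : HasDerivAt gaussPrimitive (Real.exp (-x ^ 2)) x :=
  (by fun_prop : Continuous fun v : ℝ => Real.exp (-v ^ 2)).integral_hasStrictDerivAt 0 x
    |>.hasDerivAt

theorem gaussPrimitive_neg (x : ℝ) : gaussPrimitive (-x) = -gaussPrimitive x := by
  have := intervalIntegral.integral_comp_neg (a := 0) (b := x) (fun v : ℝ => Real.exp (-v ^ 2))
  simp only [even_two, Even.neg_pow, neg_zero] at this
  rw [gaussPrimitive, gaussPrimitive, this, intervalIntegral.integral_symm]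

theorem tendsto_gaussPrimitive_atTop :
    Tendsto gaussPrimitive atTop (𝓝 (Real.sqrt Real.pi / 2)) := by
  have h := integral_gaussian_Ioi 1
  simp only [div_one] at h
  rw [← h]
  have hi : Integrable (fun v : ℝ => Real.exp (-1 * v ^ 2)) := integrable_exp_neg_mul_sq one_pos
  have := intervalIntegral_tendsto_integral_Ioi 0 hi.integrableOn tendsto_id
  simp only [id_eq, neg_one_mul] at this ⊢
  exact this

theorem tendsto_gaussPrimitive_atBot :
    Tendsto gaussPrimitive atBot (𝓝 (-(Real.sqrt Real.pi / 2))) := by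
  have := (tendsto_gaussPrimitive_atTop.comp tendsto_neg_atBot_atTop).neg
  refine this.congr fun x => ?_
  simp [gaussPrimitive_neg]

/-- The density of the one-sided stable distribution of order `1/2`. -/
noncomputable def subDensity (t r : ℝ) : ℝ :=
  t / (2 * Real.sqrt Real.pi) * (Real.exp (-(t ^ 2 / (4 * r))) / (r * Real.sqrt r))

@[fun_prop]
theorem measurable_subDensity : Measurable (fun z : ℝ × ℝ => subDensity z.1 z.2) := by
  unfold subDensity; fun_prop

theorem subDensity_nonneg {t r : ℝ} (ht : 0 ≤ t) (hr : 0 ≤ r) : 0 ≤ subDensity t r := by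
  unfold subDensity; positivity

/-- A primitive of `subDensity t r * e^{-m² r}` in `r`. -/
noncomputable def laplacePrimitive (t m r : ℝ) : ℝ :=
  -(1 / Real.sqrt Real.pi) *
    (Real.exp (-(t * m)) * gaussPrimitive (t / (2 * Real.sqrt r) - m * Real.sqrt r) +
      Real.exp (t * m) * gaussPrimitive (t / (2 * Real.sqrt r) + m * Real.sqrt r))

/-- Completing the square, `(t/(2√r) ∓ m√r)² = t²/(4r) + m² r ∓ tm`, so the prefactors `e^{∓tm}`
give both terms the same exponential. The contributions of the derivative of `m√r` then cancel, and
those of `t/(2√r)` add up. -/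
theorem hasDerivAt_laplacePrimitive (t m : ℝ) {r : ℝ} (hr : 0 < r) :
    HasDerivAt (laplacePrimitive t m) (subDensity t r * Real.exp (-(m ^ 2 * r))) r := by
  have hs : 0 < Real.sqrt r := Real.sqrt_pos.2 hr
  have hq := Real.hasDerivAt_sqrt hr.ne'
  have h1 : HasDerivAt (fun r => t / (2 * Real.sqrt r))
      (-(t / (4 * (r * Real.sqrt r)))) r := by
    refine ((hasDerivAt_const r t).div (hq.const_mul 2) (by positivity)).congr_deriv ?_
    have := Real.sq_sqrt hr.le
    field_simp
    rw [this]; ring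
  have h2 : HasDerivAt (fun r => m * Real.sqrt r) (m / (2 * Real.sqrt r)) r :=
    (hq.const_mul m).congr_deriv (by ring)
  have hA := (hasDerivAt_gaussPrimitive _).comp r (h1.sub h2)
  have hB := (hasDerivAt_gaussPrimitive _).comp r (h1.add h2)
  refine (((hA.const_mul (Real.exp (-(t * m)))).add
    (hB.const_mul (Real.exp (t * m)))).const_mul (-(1 / Real.sqrt Real.pi))).congr_deriv ?_
  have e1 : Real.exp (-(t * m)) * Real.exp (-(t / (2 * Real.sqrt r) - m * Real.sqrt r) ^ 2) =
      Real.exp (-(t ^ 2 / (4 * r))) * Real.exp (-(m ^ 2 * r)) := by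
    rw [← Real.exp_add, ← Real.exp_add]; congr 1
    have := Real.sq_sqrt hr.le
    rw [show t ^ 2 / (4 * r) = t ^ 2 / (4 * Real.sqrt r ^ 2) by rw [this],
      show m ^ 2 * r = m ^ 2 * Real.sqrt r ^ 2 by rw [this]]
    field_simp; ring
  have e2 : Real.exp (t * m) * Real.exp (-(t / (2 * Real.sqrt r) + m * Real.sqrt r) ^ 2) =
      Real.exp (-(t ^ 2 / (4 * r))) * Real.exp (-(m ^ 2 * r)) := by
    rw [← Real.exp_add, ← Real.exp_add]; congr 1
    have := Real.sq_sqrt hr.le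
    rw [show t ^ 2 / (4 * r) = t ^ 2 / (4 * Real.sqrt r ^ 2) by rw [this],
      show m ^ 2 * r = m ^ 2 * Real.sqrt r ^ 2 by rw [this]]
    field_simp; ring
  simp only [Pi.sub_apply, Pi.add_apply]
  rw [← mul_assoc, ← mul_assoc (Real.exp (t * m)), e1, e2, subDensity]
  field_simp
  ring

theorem tendsto_laplacePrimitive_zero {t : ℝ} (ht : 0 < t) (m : ℝ) :
    Tendsto (laplacePrimitive t m) (𝓝[>] 0)
      (𝓝 (-(1 / 2) * (Real.exp (-(t * m)) + Real.exp (t * m)))) := by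
  have hs : Tendsto Real.sqrt (𝓝[>] 0) (𝓝[>] 0) := by
    refine tendsto_nhdsWithin_iff.2 ⟨?_, ?_⟩
    · simpa using (Real.continuous_sqrt.tendsto 0).mono_left nhdsWithin_le_nhds
    · filter_upwards [self_mem_nhdsWithin] with r hr using Real.sqrt_pos.2 hr
  have h1 : Tendsto (fun r => t / (2 * Real.sqrt r)) (𝓝[>] 0) atTop := by
    have := (tendsto_inv_nhdsGT_zero.comp hs).const_mul_atTop (half_pos ht)
    refine this.congr fun r => ?_
    simp only [Function.comp]; ring
  have h2 : Tendsto (fun r => m * Real.sqrt r) (𝓝[>] 0) (𝓝 (m * 0)) :=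
    (hs.mono_right nhdsWithin_le_nhds).const_mul m
  have hA := tendsto_gaussPrimitive_atTop.comp (h1.atTop_add h2.neg)
  have hB := tendsto_gaussPrimitive_atTop.comp (h1.atTop_add h2)
  have := ((hA.const_mul (Real.exp (-(t * m)))).add (hB.const_mul (Real.exp (t * m)))).const_mul
    (-(1 / Real.sqrt Real.pi))
  refine (this.congr fun r => ?_).trans_eq ?_
  · simp only [laplacePrimitive, Function.comp, sub_eq_add_neg]
  · congr 1
    have : Real.sqrt Real.pi ≠ 0 := by positivity
    field_simp

theorem tendsto_laplacePrimitive_atTop {t m : ℝ} (hm : 0 ≤ m) :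
    Tendsto (laplacePrimitive t m) atTop
      (𝓝 (-(1 / 2) * (-Real.exp (-(t * m)) + Real.exp (t * m)))) := by
  have h1 : Tendsto (fun r => t / (2 * Real.sqrt r)) atTop (𝓝 0) :=
    (tendsto_const_nhds (x := t)).div_atTop (Real.tendsto_sqrt_atTop.const_mul_atTop two_pos)
  rcases hm.eq_or_lt with rfl | hm
  · have h0 : Tendsto gaussPrimitive (𝓝 0) (𝓝 0) := by
      have := (hasDerivAt_gaussPrimitive 0).continuousAt.tendsto
      simpa [gaussPrimitive] using this
    have hA := h0.comp h1
    have := ((hA.const_mul (Real.exp (-(t * 0)))).add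
      (hA.const_mul (Real.exp (t * 0)))).const_mul (-(1 / Real.sqrt Real.pi))
    refine (this.congr fun r => ?_).trans_eq ?_
    · simp [laplacePrimitive, Function.comp]
    · simp
  · have h2 : Tendsto (fun r => m * Real.sqrt r) atTop atTop :=
      Real.tendsto_sqrt_atTop.const_mul_atTop hm
    have hA := tendsto_gaussPrimitive_atBot.comp (h1.add_atBot (tendsto_neg_atTop_atBot.comp h2))
    have hB := tendsto_gaussPrimitive_atTop.comp (h1.add_atTop h2)
    have := ((hA.const_mul (Real.exp (-(t * m)))).add (hB.const_mul (Real.exp (t * m)))).const_mul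
      (-(1 / Real.sqrt Real.pi))
    refine (this.congr fun r => ?_).trans_eq ?_
    · simp only [laplacePrimitive, Function.comp, sub_eq_add_neg]
    · congr 1
      have : Real.sqrt Real.pi ≠ 0 := by positivity
      field_simp

theorem laplace_subDensity {t m : ℝ} (ht : 0 < t) (hm : 0 ≤ m) :
    IntegrableOn (fun r => subDensity t r * Real.exp (-(m ^ 2 * r))) (Ioi 0) ∧
      ∫ r in Ioi 0, subDensity t r * Real.exp (-(m ^ 2 * r)) = Real.exp (-(t * m)) := by
  set L := -(1 / 2) * (Real.exp (-(t * m)) + Real.exp (t * m))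
  -- At `r = 0` division by zero gives the primitive the value 0 instead of its limit `L`, so that
  -- value is corrected.
  have hc : ContinuousWithinAt (Function.update (laplacePrimitive t m) 0 L) (Ici 0) 0 := by
    rw [continuousWithinAt_update_same, Ici_sdiff_left]
    exact tendsto_laplacePrimitive_zero ht m
  have hd : ∀ r ∈ Ioi (0 : ℝ), HasDerivAt (Function.update (laplacePrimitive t m) 0 L)
      (subDensity t r * Real.exp (-(m ^ 2 * r))) r := fun r hr => by
    refine (hasDerivAt_laplacePrimitive t m hr).congr_of_eventuallyEq ?_
    filter_upwards [Ioi_mem_nhds hr] with q hq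
    rw [Function.update_of_ne (ne_of_gt hq)]
  have hp : ∀ r ∈ Ioi (0 : ℝ), 0 ≤ subDensity t r * Real.exp (-(m ^ 2 * r)) := fun r hr =>
    mul_nonneg (subDensity_nonneg ht.le (le_of_lt hr)) (Real.exp_pos _).le
  have hl : Tendsto (Function.update (laplacePrimitive t m) 0 L) atTop
      (𝓝 (-(1 / 2) * (-Real.exp (-(t * m)) + Real.exp (t * m)))) := by
    refine (tendsto_laplacePrimitive_atTop hm).congr' ?_
    filter_upwards [Ioi_mem_atTop 0] with q hq
    rw [Function.update_of_ne (ne_of_gt hq)]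
  refine ⟨integrableOn_Ioi_deriv_of_nonneg hc hd hp hl, ?_⟩
  rw [integral_Ioi_of_hasDerivAt_of_nonneg hc hd hp hl, Function.update_self]
  simp only [L]; ring

/-- Subordination with respect to the stable density. -/
theorem poissonHermite_eq {d : ℕ} {t : ℝ} (ht : 0 < t) (f : EuclideanSpace ℝ (Fin d) → ℝ)
    (x : EuclideanSpace ℝ (Fin d)) :
    poissonHermite t f x = ∫ r in Ioi 0, subDensity t r * ouSemigroup r f x := by
  set c := t ^ 2 / 4
  have hc : 0 < c := by positivity
  rw [poissonHermite]
  -- The substitution `u = t²/(4r)`, carried out as a scaling by `c` followed by the inversion `v =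
  -- r⁻¹`.
  have h1 := integral_comp_mul_left_Ioi' (fun u => Real.exp (-u) / Real.sqrt u *
    ouSemigroup (t ^ 2 / (4 * u)) f x) 0 hc
  have h2 := integral_comp_rpow_Ioi (fun v => Real.exp (-(c * v)) / Real.sqrt (c * v) *
    ouSemigroup (t ^ 2 / (4 * (c * v))) f x) (p := -1) (by norm_num)
  rw [mul_zero] at h1
  rw [← h1, ← h2, smul_eq_mul, ← integral_const_mul, ← integral_const_mul]
  refine setIntegral_congr_fun measurableSet_Ioi fun r (hr : 0 < r) => ?_
  have hs : 0 < Real.sqrt r := Real.sqrt_pos.2 hr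
  have e1 : t ^ 2 / (4 * (c * r ^ (-1 : ℝ))) = r := by
    rw [Real.rpow_neg_one]; simp only [c]; field_simp
  have e2 : Real.sqrt (c * r ^ (-1 : ℝ)) = t / (2 * Real.sqrt r) := by
    rw [Real.rpow_neg_one, Real.sqrt_mul hc.le, Real.sqrt_inv]
    simp only [c]
    rw [Real.sqrt_div' _ (by norm_num), Real.sqrt_sq ht.le,
      show (4 : ℝ) = 2 ^ 2 by norm_num, Real.sqrt_sq (by norm_num)]
    field_simp
  have e3 : r ^ (-1 - 1 : ℝ) = (r ^ 2)⁻¹ := by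
    rw [← Real.rpow_natCast, ← Real.rpow_neg hr.le]; norm_num
  have e4 : c * r ^ (-1 : ℝ) = t ^ 2 / (4 * r) := by
    rw [Real.rpow_neg_one]; simp only [c]; field_simp
  simp only [smul_eq_mul]
  rw [e1, e2, e3, e4, subDensity]
  have := Real.sq_sqrt hr.le
  simp only [c, abs_neg, abs_one, one_mul]
  have h3 : r ^ 2 = r * Real.sqrt r ^ 2 := by rw [this]; ring
  rw [h3]
  field_simp
  ring

/-! ### Uniqueness for Laplace transforms on the half-line. -/

theorem lintegral_exp_tilt (μ : Measure ℝ) (x : ℝ) :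
    ∫⁻ r, ENNReal.ofReal (Real.exp (x * r))
        ∂(μ.withDensity fun r => ENNReal.ofReal (Real.exp (-r))) =
      ∫⁻ r, ENNReal.ofReal (Real.exp (-((1 - x) * r))) ∂μ := by
  rw [lintegral_withDensity_eq_lintegral_mul _ (by fun_prop) (by fun_prop)]
  refine lintegral_congr fun r => ?_
  rw [Pi.mul_apply, ← ENNReal.ofReal_mul (Real.exp_pos _).le, ← Real.exp_add]
  ring_nf

theorem lintegral_exp_neg_lt_top {μ : Measure ℝ} [IsFiniteMeasure μ] (hμ : ∀ᵐ r ∂μ, 0 ≤ r)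
    {l : ℝ} (hl : 0 ≤ l) : ∫⁻ r, ENNReal.ofReal (Real.exp (-(l * r))) ∂μ < ∞ := by
  refine lt_of_le_of_lt (b := ∫⁻ _, 1 ∂μ) (lintegral_mono_ae ?_) (by simp)
  filter_upwards [hμ] with r hr
  rw [← ENNReal.ofReal_one]
  refine ENNReal.ofReal_le_ofReal ?_
  rw [Real.exp_le_one_iff]
  nlinarith [mul_nonneg hl hr]

/-- A finite measure on the half-line is determined by its Laplace transform. -/
theorem ext_of_laplace {μ ν : Measure ℝ} [IsFiniteMeasure μ] [IsFiniteMeasure ν]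
    (hμ : ∀ᵐ r ∂μ, 0 ≤ r) (hν : ∀ᵐ r ∂ν, 0 ≤ r)
    (h : ∀ l : ℝ, 0 ≤ l → ∫⁻ r, ENNReal.ofReal (Real.exp (-(l * r))) ∂μ =
      ∫⁻ r, ENNReal.ofReal (Real.exp (-(l * r))) ∂ν) : μ = ν := by
  -- Tilting by `e^{-r}` makes the moment generating function finite on `(-∞, 1)`, a neighbourhood
  -- of 0. The complex one is then analytic on `Re z < 1`, a region containing the imaginary axis,
  -- where it is the characteristic function.
  set w : ℝ → ℝ≥0∞ := fun r => ENNReal.ofReal (Real.exp (-r))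
  have hw : Measurable w := by fun_prop
  have hw0 : ∀ r, w r ≠ 0 := fun r => by simp [w, Real.exp_pos]
  have hwt : ∀ r, w r ≠ ∞ := fun r => ENNReal.ofReal_ne_top
  have hfin : ∀ (ρ : Measure ℝ) [IsFiniteMeasure ρ], (∀ᵐ r ∂ρ, 0 ≤ r) →
      IsFiniteMeasure (ρ.withDensity w) := fun ρ _ hρ => by
    refine isFiniteMeasure_withDensity ?_
    simpa [w] using (lintegral_exp_neg_lt_top hρ zero_le_one).ne
  have := hfin μ hμ
  have := hfin ν hν
  have hset : ∀ (ρ : Measure ℝ) [IsFiniteMeasure ρ], (∀ᵐ r ∂ρ, 0 ≤ r) →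
      Iio 1 ⊆ interior (integrableExpSet id (ρ.withDensity w)) := fun ρ _ hρ => by
    refine interior_maximal (fun x (hx : x < 1) => ?_) isOpen_Iio
    refine ⟨by fun_prop, ?_⟩
    rw [hasFiniteIntegral_iff_ofReal (ae_of_all _ fun _ => (Real.exp_pos _).le)]
    simp only [id]
    rw [lintegral_exp_tilt]
    exact lintegral_exp_neg_lt_top hρ (by linarith)
  have hmgf : ∀ x : ℝ, x < 1 → mgf id (μ.withDensity w) x = mgf id (ν.withDensity w) x := by
    intro x hx
    simp only [mgf, id]
    rw [integral_eq_lintegral_of_nonneg_ae (ae_of_all _ fun _ => (Real.exp_pos _).le)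
      (by fun_prop), integral_eq_lintegral_of_nonneg_ae
      (ae_of_all _ fun _ => (Real.exp_pos _).le) (by fun_prop), lintegral_exp_tilt,
      lintegral_exp_tilt, h _ (by linarith)]
  have heq : EqOn (complexMGF id (μ.withDensity w)) (complexMGF id (ν.withDensity w))
      {z | z.re < 1} := by
    have han : ∀ (ρ : Measure ℝ) [IsFiniteMeasure ρ], (∀ᵐ r ∂ρ, 0 ≤ r) →
        AnalyticOnNhd ℂ (complexMGF id (ρ.withDensity w)) {z | z.re < 1} := fun ρ _ hρ z hz =>
      analyticOnNhd_complexMGF z (hset ρ hρ hz)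
    refine (han μ hμ).eqOn_of_preconnected_of_frequently_eq (han ν hν)
      (convex_halfSpace_re_lt 1).isPreconnected (z₀ := 0) (by simp) ?_
    have ht : Tendsto (fun x : ℝ => (x : ℂ)) (𝓝[≠] 0) (𝓝[≠] 0) := by
      refine tendsto_nhdsWithin_iff.2 ⟨?_, ?_⟩
      · simpa using (Complex.continuous_ofReal.tendsto 0).mono_left nhdsWithin_le_nhds
      · filter_upwards [self_mem_nhdsWithin] with x hx
        simpa using hx
    refine ht.frequently (Eventually.frequently ?_)
    filter_upwards [nhdsWithin_le_nhds (Iio_mem_nhds (zero_lt_one' ℝ))] with x hx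
    rw [complexMGF_ofReal, complexMGF_ofReal, hmgf x hx]
  have hww : μ.withDensity w = ν.withDensity w := by
    refine Measure.ext_of_charFun ?_
    ext t
    rw [← complexMGF_id_mul_I, ← complexMGF_id_mul_I]
    exact heq (by simp)
  -- The tilt is undone, its density being everywhere positive and finite.
  rw [← withDensity_inv_same (μ := μ) hw (ae_of_all _ hw0) (ae_of_all _ hwt), hww,
    withDensity_inv_same hw (ae_of_all _ hw0) (ae_of_all _ hwt)]

/-! ### The subordinating measures: domination, convolution and differentiation in `t`. -/

/-- The one-sided stable distribution of order `1/2`, as a measure. -/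
noncomputable def subMeasure (t : ℝ) : Measure ℝ :=
  (volume.restrict (Ioi 0)).withDensity fun r => ENNReal.ofReal (subDensity t r)

/-- The measure with density `t / (2 r)` with respect to `subMeasure t`. -/
noncomputable def subWeighted (t : ℝ) : Measure ℝ :=
  (volume.restrict (Ioi 0)).withDensity fun r =>
    ENNReal.ofReal (t / (2 * r)) * ENNReal.ofReal (subDensity t r)

theorem measurable_ofReal_subDensity (t : ℝ) :
    Measurable fun r => ENNReal.ofReal (subDensity t r) := by unfold subDensity; fun_prop

/-- The density is then nonpositive and `ENNReal.ofReal` truncates it. This lets finiteness be an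
instance for every real `t`. -/
theorem subMeasure_of_nonpos {t : ℝ} (ht : t ≤ 0) : subMeasure t = 0 := by
  rw [subMeasure, withDensity_eq_zero_iff (measurable_ofReal_subDensity t).aemeasurable]
  filter_upwards [ae_restrict_mem measurableSet_Ioi] with r (hr : 0 < r)
  rw [Pi.zero_apply, ENNReal.ofReal_eq_zero, subDensity]
  exact mul_nonpos_of_nonpos_of_nonneg (div_nonpos_of_nonpos_of_nonneg ht (by positivity))
    (by positivity)

theorem lintegral_exp_subMeasure {t l : ℝ} (ht : 0 < t) (hl : 0 ≤ l) :
    ∫⁻ r, ENNReal.ofReal (Real.exp (-(l * r))) ∂(subMeasure t) =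
      ENNReal.ofReal (Real.exp (-(t * Real.sqrt l))) := by
  have h := laplace_subDensity ht (Real.sqrt_nonneg l)
  rw [Real.sq_sqrt hl] at h
  rw [← h.2, ofReal_integral_eq_lintegral_ofReal h.1, subMeasure,
    lintegral_withDensity_eq_lintegral_mul _ (measurable_ofReal_subDensity t) (by fun_prop)]
  · refine setLIntegral_congr_fun measurableSet_Ioi fun r (hr : 0 < r) => ?_
    simp only [Pi.mul_apply]
    rw [← ENNReal.ofReal_mul (subDensity_nonneg ht.le hr.le)]
  · filter_upwards [ae_restrict_mem measurableSet_Ioi] with r (hr : 0 < r)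
    exact mul_nonneg (subDensity_nonneg ht.le hr.le) (Real.exp_pos _).le

theorem subMeasure_univ {t : ℝ} (ht : 0 < t) : subMeasure t univ = 1 := by
  simpa using lintegral_exp_subMeasure ht le_rfl

instance (t : ℝ) : IsFiniteMeasure (subMeasure t) := by
  rcases le_or_gt t 0 with h | h
  · rw [subMeasure_of_nonpos h]; infer_instance
  · exact ⟨by simp [subMeasure_univ h]⟩

theorem subMeasure_nonneg (t : ℝ) : ∀ᵐ r ∂(subMeasure t), 0 ≤ r :=
  (withDensity_absolutelyContinuous _ _).ae_le
    ((ae_restrict_mem measurableSet_Ioi).mono fun _ hr => le_of_lt hr)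

theorem subWeighted_nonneg (t : ℝ) : ∀ᵐ r ∂(subWeighted t), 0 ≤ r :=
  (withDensity_absolutelyContinuous _ _).ae_le
    ((ae_restrict_mem measurableSet_Ioi).mono fun _ hr => le_of_lt hr)

/-- Only the linear prefactor grows with `t`. This domination lets countably many times control all
`t > 0`. -/
theorem subDensity_le {t s r : ℝ} (hs : 0 < s) (hst : s ≤ t) (hr : 0 < r) :
    subDensity t r ≤ t / s * subDensity s r := by
  unfold subDensity
  have h : Real.exp (-(t ^ 2 / (4 * r))) ≤ Real.exp (-(s ^ 2 / (4 * r))) := by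
    rw [Real.exp_le_exp, neg_le_neg_iff]; gcongr
  have ht : 0 < t := hs.trans_le hst
  calc _ ≤ t / (2 * Real.sqrt Real.pi) * (Real.exp (-(s ^ 2 / (4 * r))) / (r * Real.sqrt r)) := by
        gcongr
    _ = _ := by field_simp

theorem weight_mul_subDensity_le {t r : ℝ} (ht : 0 < t) (hr : 0 < r) :
    t / (2 * r) * subDensity t r ≤ 8 / t * subDensity (t / 2) r := by
  unfold subDensity
  set w := t ^ 2 / (16 * r)
  have hw : 0 ≤ w := by positivity
  have e1 : t ^ 2 / (4 * r) = 4 * w := by simp only [w]; field_simp; norm_num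
  have e2 : (t / 2) ^ 2 / (4 * r) = w := by simp only [w]; field_simp; norm_num
  have e3 : t / (2 * r) = 8 * w / t := by simp only [w]; field_simp; norm_num
  rw [e1, e2, e3]
  -- Halving `t` frees a factor `e^{-3w}`, which absorbs the weight `8w/t` because `e^{3w} ≥ 1 + 3w
  -- ≥ 2w`.
  have h : 2 * w * Real.exp (-(4 * w)) ≤ Real.exp (-w) := by
    have : Real.exp (-w) = Real.exp (3 * w) * Real.exp (-(4 * w)) := by
      rw [← Real.exp_add]; ring_nf
    rw [this]
    gcongr
    linarith [Real.add_one_le_exp (3 * w)]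
  have hs : 0 < Real.sqrt r := Real.sqrt_pos.2 hr
  have hp : 0 < Real.sqrt Real.pi := by positivity
  calc _ = 2 * w * Real.exp (-(4 * w)) * (4 / (2 * Real.sqrt Real.pi * (r * Real.sqrt r))) := by
        field_simp; ring
    _ ≤ Real.exp (-w) * (4 / (2 * Real.sqrt Real.pi * (r * Real.sqrt r))) := by gcongr
    _ = _ := by field_simp; norm_num

theorem subMeasure_le {t s : ℝ} (hs : 0 < s) (hst : s ≤ t) :
    subMeasure t ≤ ENNReal.ofReal (t / s) • subMeasure s := by
  rw [subMeasure, subMeasure, ← withDensity_smul _ (measurable_ofReal_subDensity s)]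
  refine withDensity_mono ?_
  filter_upwards [ae_restrict_mem measurableSet_Ioi] with r (hr : 0 < r)
  rw [Pi.smul_apply, smul_eq_mul, ← ENNReal.ofReal_mul (div_nonneg (hs.le.trans hst) hs.le)]
  exact ENNReal.ofReal_le_ofReal (subDensity_le hs hst hr)

theorem subWeighted_le (t : ℝ) :
    subWeighted t ≤ ENNReal.ofReal (8 / t) • subMeasure (t / 2) := by
  rw [subWeighted, subMeasure, ← withDensity_smul _ (measurable_ofReal_subDensity _)]
  refine withDensity_mono ?_
  filter_upwards [ae_restrict_mem measurableSet_Ioi] with r (hr : 0 < r)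
  rw [Pi.smul_apply, smul_eq_mul]
  rcases le_or_gt t 0 with h | h
  · rw [ENNReal.ofReal_of_nonpos (div_nonpos_of_nonpos_of_nonneg h (by positivity)), zero_mul]
    exact zero_le
  · rw [← ENNReal.ofReal_mul (by positivity), ← ENNReal.ofReal_mul (by positivity)]
    exact ENNReal.ofReal_le_ofReal (weight_mul_subDensity_le h hr)

instance (t : ℝ) : IsFiniteMeasure (subWeighted t) := by
  refine ⟨(subWeighted_le t univ).trans_lt ?_⟩
  rw [Measure.smul_apply, smul_eq_mul]
  exact ENNReal.mul_lt_top ENNReal.ofReal_lt_top (measure_lt_top _ _)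

theorem ae_nonneg_conv {μ ν : Measure ℝ} [IsFiniteMeasure μ] [IsFiniteMeasure ν]
    (hμ : ∀ᵐ r ∂μ, 0 ≤ r) (hν : ∀ᵐ r ∂ν, 0 ≤ r) : ∀ᵐ r ∂(μ.conv ν), 0 ≤ r := by
  rw [Measure.conv, ae_map_iff (by fun_prop) measurableSet_Ici]
  filter_upwards [Measure.quasiMeasurePreserving_fst.ae hμ,
    Measure.quasiMeasurePreserving_snd.ae hν] with z h1 h2 using add_nonneg h1 h2

/-- The Laplace transforms `e^{-t√l}` and `e^{-s√l}` multiply to `e^{-(t+s)√l}`; this is the origin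
of the semigroup law for `P_t`. -/
theorem subMeasure_conv {t s : ℝ} (ht : 0 < t) (hs : 0 < s) :
    (subMeasure t).conv (subMeasure s) = subMeasure (t + s) := by
  refine ext_of_laplace (ae_nonneg_conv (subMeasure_nonneg t) (subMeasure_nonneg s))
    (subMeasure_nonneg _) fun l hl => ?_
  rw [Measure.lintegral_conv (by fun_prop), lintegral_exp_subMeasure (add_pos ht hs) hl]
  have : ∀ x y : ℝ, ENNReal.ofReal (Real.exp (-(l * (x + y)))) =
      ENNReal.ofReal (Real.exp (-(l * x))) * ENNReal.ofReal (Real.exp (-(l * y))) := fun x y => by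
    rw [← ENNReal.ofReal_mul (Real.exp_pos _).le, ← Real.exp_add]; ring_nf
  simp_rw [this]
  simp_rw [lintegral_const_mul _ (by fun_prop : Measurable fun y : ℝ =>
    ENNReal.ofReal (Real.exp (-(l * y))))]
  rw [lintegral_mul_const _ (by fun_prop), lintegral_exp_subMeasure ht hl,
    lintegral_exp_subMeasure hs hl, ← ENNReal.ofReal_mul (Real.exp_pos _).le, ← Real.exp_add]
  ring_nf

theorem integral_subMeasure {t : ℝ} (ht : 0 ≤ t) (g : ℝ → ℝ) :
    ∫ r, g r ∂(subMeasure t) = ∫ r in Ioi 0, subDensity t r * g r := by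
  rw [subMeasure, integral_withDensity_eq_integral_toReal_smul
    (measurable_ofReal_subDensity t) (ae_of_all _ fun _ => ENNReal.ofReal_lt_top)]
  refine setIntegral_congr_fun measurableSet_Ioi fun r (hr : 0 < r) => ?_
  simp only [smul_eq_mul]
  rw [ENNReal.toReal_ofReal (subDensity_nonneg ht hr.le)]

theorem integrable_subMeasure {t : ℝ} (ht : 0 ≤ t) (g : ℝ → ℝ) :
    Integrable g (subMeasure t) ↔ IntegrableOn (fun r => subDensity t r * g r) (Ioi 0) := by
  rw [subMeasure, integrable_withDensity_iff_integrable_smul'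
    (measurable_ofReal_subDensity t) (ae_of_all _ fun _ => ENNReal.ofReal_lt_top)]
  refine integrableOn_congr_fun (fun r (hr : 0 < r) => ?_) measurableSet_Ioi
  simp only [smul_eq_mul]
  rw [ENNReal.toReal_ofReal (subDensity_nonneg ht hr.le)]

theorem integral_subWeighted {t : ℝ} (ht : 0 ≤ t) (g : ℝ → ℝ) :
    ∫ r, g r ∂(subWeighted t) = ∫ r in Ioi 0, t / (2 * r) * subDensity t r * g r := by
  have hm : Measurable fun r : ℝ =>
      ENNReal.ofReal (t / (2 * r)) * ENNReal.ofReal (subDensity t r) :=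
    (by fun_prop : Measurable fun r : ℝ => ENNReal.ofReal (t / (2 * r))).mul
      (measurable_ofReal_subDensity t)
  rw [subWeighted, integral_withDensity_eq_integral_toReal_smul hm
    (ae_of_all _ fun _ => ENNReal.mul_lt_top ENNReal.ofReal_lt_top ENNReal.ofReal_lt_top)]
  refine setIntegral_congr_fun measurableSet_Ioi fun r (hr : 0 < r) => ?_
  simp only [smul_eq_mul]
  rw [ENNReal.toReal_mul, ENNReal.toReal_ofReal (subDensity_nonneg ht hr.le),
    ENNReal.toReal_ofReal (by positivity)]

theorem hasDerivAt_subDensity {t r : ℝ} (ht : t ≠ 0) (hr : 0 < r) :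
    HasDerivAt (fun t => subDensity t r)
      (1 / t * subDensity t r - t / (2 * r) * subDensity t r) t := by
  unfold subDensity
  have h1 : HasDerivAt (fun t : ℝ => Real.exp (-(t ^ 2 / (4 * r))))
      (Real.exp (-(t ^ 2 / (4 * r))) * -(2 * t / (4 * r))) t := by
    have := ((hasDerivAt_pow 2 t).div_const (4 * r)).neg.exp
    simpa using this
  refine (((hasDerivAt_id t).div_const _).mul (h1.div_const _)).congr_deriv ?_
  simp only [id]
  field_simp
  ring

/-- Differentiation in `t` of an integral against the stable density. -/
theorem hasDerivAt_integral_subMeasure {g : ℝ → ℝ} {t s : ℝ} (hs : 0 < s) (hst : 4 * s ≤ t)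
    (hg : Integrable g (subMeasure s)) :
    HasDerivAt (fun t => ∫ r, g r ∂(subMeasure t))
      (1 / t * ∫ r, g r ∂(subMeasure t) - ∫ r, g r ∂(subWeighted t)) t := by
  have ht : 0 < t := by linarith
  have hg' := (integrable_subMeasure hs.le g).1 hg
  have hint : ∀ q, s ≤ q → IntegrableOn (fun r => subDensity q r * g r) (Ioi 0) := fun q hq => by
    rw [← integrable_subMeasure (hs.le.trans hq)]
    exact (hg.smul_measure ENNReal.ofReal_ne_top).mono_measure (subMeasure_le hs hq)
  have hintw : IntegrableOn (fun r => t / (2 * r) * subDensity t r * g r) (Ioi 0) := by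
    have h2 := (hint (t / 2) (by linarith)).norm.const_mul (8 / t)
    refine h2.mono' ?_ ?_
    · simp_rw [mul_assoc]
      exact (by fun_prop : Measurable fun r : ℝ => t / (2 * r)).aestronglyMeasurable.mul
        (hint t (by linarith)).aestronglyMeasurable
    · filter_upwards [ae_restrict_mem measurableSet_Ioi] with r (hr : 0 < r)
      rw [norm_mul _ (g r), norm_mul _ (g r), ← mul_assoc, Real.norm_of_nonneg
        (mul_nonneg (by positivity) (subDensity_nonneg ht.le hr.le)),
        Real.norm_of_nonneg (subDensity_nonneg (by linarith) hr.le)]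
      exact mul_le_mul_of_nonneg_right (weight_mul_subDensity_le ht hr) (norm_nonneg _)
  -- On the neighbourhood `q > 2s` one still has `q/2 > s`, so both terms of the derivative are
  -- controlled by the density at time `s`: the first by `1/s` times it, the second, via time `q/2`,
  -- by `4/s` times it. Hence the bound `5/s`.
  have key := hasDerivAt_integral_of_dominated_loc_of_deriv_le
    (μ := volume.restrict (Ioi 0)) (x₀ := t) (s := Ioi (2 * s))
    (F := fun t r => subDensity t r * g r)
    (F' := fun t r => (1 / t * subDensity t r - t / (2 * r) * subDensity t r) * g r)
    (bound := fun r => 5 / s * ‖subDensity s r * g r‖) (Ioi_mem_nhds (by linarith)) ?_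
    (hint t (by linarith)) ?_ ?_ (hg'.norm.const_mul _) ?_
  · have h1 := key.2
    have e : (fun q => ∫ r, g r ∂(subMeasure q)) =ᶠ[𝓝 t]
        fun q => ∫ r in Ioi 0, subDensity q r * g r := by
      filter_upwards [Ioi_mem_nhds ht] with q hq using integral_subMeasure (le_of_lt hq) g
    refine (h1.congr_of_eventuallyEq e).congr_deriv ?_
    rw [integral_subMeasure ht.le, integral_subWeighted ht.le, ← integral_const_mul,
      ← integral_sub ((hint t (by linarith)).const_mul _) hintw]
    simp_rw [sub_mul, mul_assoc]
  · filter_upwards [Ioi_mem_nhds (show s < t by linarith)] with q hq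
    exact (hint q (le_of_lt hq)).aestronglyMeasurable
  · simp_rw [sub_mul, mul_assoc]
    simp_rw [mul_assoc] at hintw
    exact ((hint t (by linarith)).const_mul (1 / t)).aestronglyMeasurable.sub
      hintw.aestronglyMeasurable
  · filter_upwards [ae_restrict_mem measurableSet_Ioi] with r (hr : 0 < r) q (hq : 2 * s < q)
    have hq0 : 0 < q := by linarith
    rw [norm_mul, norm_mul, ← mul_assoc,
      Real.norm_of_nonneg (subDensity_nonneg hs.le hr.le)]
    refine mul_le_mul_of_nonneg_right ?_ (norm_nonneg _)
    have h1 : 1 / q * subDensity q r ≤ 1 / s * subDensity s r := by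
      calc 1 / q * subDensity q r ≤ 1 / q * (q / s * subDensity s r) := by
            gcongr; exact subDensity_le hs (by linarith) hr
        _ = _ := by field_simp
    have h2 : q / (2 * r) * subDensity q r ≤ 4 / s * subDensity s r := by
      calc q / (2 * r) * subDensity q r ≤ 8 / q * subDensity (q / 2) r :=
            weight_mul_subDensity_le hq0 hr
        _ ≤ 8 / q * (q / 2 / s * subDensity s r) := by
            gcongr; exact subDensity_le hs (by linarith) hr
        _ = _ := by field_simp; ring
    have h3 : 0 ≤ 1 / q * subDensity q r :=
      mul_nonneg (by positivity) (subDensity_nonneg hq0.le hr.le)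
    have h4 : 0 ≤ q / (2 * r) * subDensity q r :=
      mul_nonneg (by positivity) (subDensity_nonneg hq0.le hr.le)
    have h5 : 5 / s * subDensity s r = 1 / s * subDensity s r + 4 / s * subDensity s r := by ring
    rw [Real.norm_eq_abs, abs_le, h5]
    constructor <;> linarith
  · filter_upwards [ae_restrict_mem measurableSet_Ioi] with r (hr : 0 < r) q (hq : 2 * s < q)
    exact (hasDerivAt_subDensity (by linarith) hr).mul_const _

/-! ### Averaging operators on `L^p(γ_d)`. -/

section MixAvg

variable {d : ℕ} {ρ σ : Measure ℝ} [IsFiniteMeasure ρ] [IsFiniteMeasure σ]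
  {f g : EuclideanSpace ℝ (Fin d) → ℝ}

/-- The average of `f` with respect to a mixture of Ornstein–Uhlenbeck kernels. -/
noncomputable def mixAvg {d : ℕ} (ρ : Measure ℝ) [IsFiniteMeasure ρ]
    (f : EuclideanSpace ℝ (Fin d) → ℝ) (x : EuclideanSpace ℝ (Fin d)) : ℝ :=
  ∫ y, f y ∂(mixKernel d ρ x)

/-- Invariance of `γ_d`: a `γ_d`-null set is null for the kernel at almost every starting point, so
averages do not depend on the representative of `f`. -/
theorem ae_mixKernel_of_ae (hρ : ∀ᵐ r ∂ρ, 0 ≤ r) {p : EuclideanSpace ℝ (Fin d) → Prop}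
    (h : ∀ᵐ y ∂(gaussMeasure d), p y) :
    ∀ᵐ x ∂(gaussMeasure d), ∀ᵐ y ∂(mixKernel d ρ x), p y := by
  refine Measure.ae_ae_of_ae_comp ?_
  rw [mixKernel_comp_gaussMeasure d hρ]
  exact Measure.ae_smul_measure h _

theorem ae_integrable_mixKernel (hρ : ∀ᵐ r ∂ρ, 0 ≤ r) (hf : Integrable f (gaussMeasure d)) :
    ∀ᵐ x ∂(gaussMeasure d), Integrable f (mixKernel d ρ x) := by
  refine Measure.ae_integrable_of_integrable_comp ?_
  rw [mixKernel_comp_gaussMeasure d hρ]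
  exact hf.smul_measure (measure_ne_top _ _)

theorem mixAvg_congr (hρ : ∀ᵐ r ∂ρ, 0 ≤ r) (h : f =ᵐ[gaussMeasure d] g) :
    mixAvg ρ f =ᵐ[gaussMeasure d] mixAvg ρ g := by
  filter_upwards [ae_mixKernel_of_ae hρ h] with x hx using integral_congr_ae hx

theorem stronglyMeasurable_mixAvg (hf : StronglyMeasurable f) :
    StronglyMeasurable (mixAvg ρ f) := hf.integral_kernel

theorem aestronglyMeasurable_mixAvg (hρ : ∀ᵐ r ∂ρ, 0 ≤ r)
    (hf : AEStronglyMeasurable f (gaussMeasure d)) :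
    AEStronglyMeasurable (mixAvg ρ f) (gaussMeasure d) :=
  ⟨_, stronglyMeasurable_mixAvg hf.stronglyMeasurable_mk, mixAvg_congr hρ hf.ae_eq_mk⟩

theorem integrable_comp_mixKernel {x : EuclideanSpace ℝ (Fin d)}
    (hf : Integrable f (mixKernel d ρ x)) :
    Integrable (fun z : ℝ × EuclideanSpace ℝ (Fin d) =>
      f (ouScale z.1 • z.2 + Real.exp (-z.1) • x)) (ρ.prod (gaussMeasure d)) := by
  rw [mixKernel_apply] at hf
  exact (integrable_map_measure hf.aestronglyMeasurable (by fun_prop)).1 hf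

theorem integrable_ouSemigroup {x : EuclideanSpace ℝ (Fin d)}
    (hf : Integrable f (mixKernel d ρ x)) : Integrable (fun r => ouSemigroup r f x) ρ :=
  (integrable_comp_mixKernel hf).integral_prod_left

theorem mixAvg_eq_integral {x : EuclideanSpace ℝ (Fin d)}
    (hf : Integrable f (mixKernel d ρ x)) : mixAvg ρ f x = ∫ r, ouSemigroup r f x ∂ρ := by
  have h := integrable_comp_mixKernel hf
  rw [mixAvg]
  rw [mixKernel_apply] at hf ⊢
  rw [integral_map (by fun_prop) hf.aestronglyMeasurable, integral_prod _ h]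
  rfl

/-- Mixtures of Ornstein–Uhlenbeck kernels act boundedly on `L^p(γ_d)`. -/
theorem eLpNorm_mixAvg_le (hρ : ∀ᵐ r ∂ρ, 0 ≤ r) {p : ℝ≥0∞} (hp : 1 ≤ p) (hpt : p ≠ ∞)
    (hf : AEStronglyMeasurable f (gaussMeasure d)) :
    eLpNorm (mixAvg ρ f) p (gaussMeasure d) ≤ ρ univ * eLpNorm f p (gaussMeasure d) := by
  have hp0 : p ≠ 0 := (zero_lt_one.trans_le hp).ne'
  have hpr : 0 < p.toReal := ENNReal.toReal_pos hp0 hpt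
  have hpr1 : 1 ≤ p.toReal := by simpa using ENNReal.toReal_mono hpt hp
  have hbind := mixKernel_comp_gaussMeasure d hρ
  set F : EuclideanSpace ℝ (Fin d) → ℝ≥0∞ := fun x => ∫⁻ y, ‖f y‖ₑ ^ p.toReal ∂(mixKernel d ρ x)
  -- The Hölder factor for a kernel of total mass `ρ univ`. Invariance supplies the missing power
  -- `1/p` of the mass.
  set c : ℝ≥0∞ := ρ univ ^ (1 - 1 / p.toReal)
  have hsm : ∀ᵐ x ∂(gaussMeasure d), AEStronglyMeasurable f (mixKernel d ρ x) := by
    filter_upwards [ae_mixKernel_of_ae hρ hf.ae_eq_mk] with x hx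
    exact ⟨_, hf.stronglyMeasurable_mk, hx⟩
  have h1 : ∀ᵐ x ∂(gaussMeasure d),
      ‖mixAvg ρ f x‖ₑ ^ p.toReal ≤ c ^ p.toReal * F x := by
    filter_upwards [hsm] with x hx
    have ha : ‖mixAvg ρ f x‖ₑ ≤ eLpNorm f 1 (mixKernel d ρ x) := by
      rw [eLpNorm_one_eq_lintegral_enorm]; exact enorm_integral_le_lintegral_enorm _
    have hb := eLpNorm_le_eLpNorm_mul_rpow_measure_univ hp hx
    rw [mixKernel_univ, ENNReal.toReal_one, div_one] at hb
    refine (ENNReal.rpow_le_rpow (ha.trans hb) hpr.le).trans_eq ?_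
    rw [ENNReal.mul_rpow_of_nonneg _ _ hpr.le, eLpNorm_eq_lintegral_rpow_enorm_toReal hp0 hpt,
      ← ENNReal.rpow_mul, one_div_mul_cancel hpr.ne', ENNReal.rpow_one, mul_comm]
  have hmeas : AEMeasurable (fun y => ‖f y‖ₑ ^ p.toReal)
      ((gaussMeasure d).bind (mixKernel d ρ)) := by
    rw [hbind]
    exact (hf.enorm.pow_const _).smul_measure _
  have h2 : ∫⁻ x, F x ∂(gaussMeasure d) =
      ρ univ * ∫⁻ y, ‖f y‖ₑ ^ p.toReal ∂(gaussMeasure d) := by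
    rw [← Measure.lintegral_bind (mixKernel d ρ).measurable.aemeasurable hmeas, hbind,
      lintegral_smul_measure, smul_eq_mul]
  have hct : c ^ p.toReal ≠ ∞ := by
    refine ENNReal.rpow_ne_top_of_nonneg hpr.le (ENNReal.rpow_ne_top_of_nonneg ?_
      (measure_ne_top _ _))
    rw [sub_nonneg, div_le_one hpr]; exact hpr1
  rw [eLpNorm_eq_lintegral_rpow_enorm_toReal hp0 hpt, eLpNorm_eq_lintegral_rpow_enorm_toReal hp0 hpt]
  calc (∫⁻ x, ‖mixAvg ρ f x‖ₑ ^ p.toReal ∂(gaussMeasure d)) ^ (1 / p.toReal)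
      ≤ (c ^ p.toReal * (ρ univ * ∫⁻ y, ‖f y‖ₑ ^ p.toReal ∂(gaussMeasure d))) ^
          (1 / p.toReal) := by
        refine ENNReal.rpow_le_rpow ?_ (by positivity)
        rw [← h2, ← lintegral_const_mul' _ _ hct]
        exact lintegral_mono_ae h1
    _ = c * ρ univ ^ (1 / p.toReal) *
        (∫⁻ y, ‖f y‖ₑ ^ p.toReal ∂(gaussMeasure d)) ^ (1 / p.toReal) := by
        rw [ENNReal.mul_rpow_of_nonneg _ _ (by positivity),
          ENNReal.mul_rpow_of_nonneg _ _ (by positivity), ← ENNReal.rpow_mul,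
          mul_one_div_cancel hpr.ne', ENNReal.rpow_one, mul_assoc]
    _ = _ := by
        congr 1
        rw [← ENNReal.rpow_add_of_nonneg _ _ (by rw [sub_nonneg, div_le_one hpr]; exact hpr1)
          (by positivity), sub_add_cancel, ENNReal.rpow_one]

theorem memLp_mixAvg (hρ : ∀ᵐ r ∂ρ, 0 ≤ r) {p : ℝ≥0∞} (hp : 1 ≤ p) (hpt : p ≠ ∞)
    (hf : MemLp f p (gaussMeasure d)) : MemLp (mixAvg ρ f) p (gaussMeasure d) :=
  ⟨aestronglyMeasurable_mixAvg hρ hf.1, (eLpNorm_mixAvg_le hρ hp hpt hf.1).trans_lt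
    (ENNReal.mul_lt_top (measure_lt_top _ _) hf.2)⟩

theorem integrable_mixAvg (hρ : ∀ᵐ r ∂ρ, 0 ≤ r) (hf : Integrable f (gaussMeasure d)) :
    Integrable (mixAvg ρ f) (gaussMeasure d) := by
  rw [← memLp_one_iff_integrable] at hf ⊢
  exact memLp_mixAvg hρ le_rfl ENNReal.one_ne_top hf

theorem mixAvg_mixAvg (hρ : ∀ᵐ r ∂ρ, 0 ≤ r) (hσ : ∀ᵐ r ∂σ, 0 ≤ r)
    (hf : Integrable f (gaussMeasure d)) :
    mixAvg ρ (mixAvg σ f) =ᵐ[gaussMeasure d] mixAvg (ρ.conv σ) f := by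
  filter_upwards [ae_integrable_mixKernel (ae_nonneg_conv hρ hσ) hf] with x hx
  rw [mixAvg, mixAvg]
  rw [← mixKernel_comp d hρ hσ] at hx ⊢
  rw [Kernel.integral_comp hx]
  rfl

theorem mixAvg_comm (hρ : ∀ᵐ r ∂ρ, 0 ≤ r) (hσ : ∀ᵐ r ∂σ, 0 ≤ r)
    (hf : Integrable f (gaussMeasure d)) :
    mixAvg ρ (mixAvg σ f) =ᵐ[gaussMeasure d] mixAvg σ (mixAvg ρ f) := by
  filter_upwards [mixAvg_mixAvg hρ hσ hf, mixAvg_mixAvg hσ hρ hf] with x h1 h2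
  rw [h1, h2]
  simp only [Measure.conv_comm ρ σ]

end MixAvg

/-! ### The Poisson–Hermite semigroup and its derivative in `t`. -/

section Poisson

variable {d : ℕ} {f g : EuclideanSpace ℝ (Fin d) → ℝ} {x : EuclideanSpace ℝ (Fin d)}

/-- The points at which all the averages defining `P_t f`, `t > 0`, converge absolutely. -/
def PoissonRegular {d : ℕ} (f : EuclideanSpace ℝ (Fin d) → ℝ)
    (x : EuclideanSpace ℝ (Fin d)) : Prop :=
  ∀ n : ℕ, Integrable f (mixKernel d (subMeasure (1 / ((n : ℝ) + 1))) x)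

theorem ae_poissonRegular (hf : Integrable f (gaussMeasure d)) :
    ∀ᵐ x ∂(gaussMeasure d), PoissonRegular f x :=
  ae_all_iff.2 fun _ => ae_integrable_mixKernel (subMeasure_nonneg _) hf

/-- The law at time `t` is dominated by a multiple of the law at any smaller time `1/(n+1)`.
Regularity thus costs a single null set, valid for all `t` at once. -/
theorem PoissonRegular.integrable (h : PoissonRegular f x) {t : ℝ} (ht : 0 < t) :
    Integrable f (mixKernel d (subMeasure t) x) := by
  obtain ⟨n, hn⟩ := exists_nat_one_div_lt ht
  exact ((h n).smul_measure ENNReal.ofReal_ne_top).mono_measure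
    (mixKernel_mono d (subMeasure_le (by positivity) hn.le) x)

theorem PoissonRegular.integrable_weighted (h : PoissonRegular f x) {t : ℝ} (ht : 0 < t) :
    Integrable f (mixKernel d (subWeighted t) x) :=
  ((h.integrable (half_pos ht)).smul_measure ENNReal.ofReal_ne_top).mono_measure
    (mixKernel_mono d (subWeighted_le t) x)

theorem PoissonRegular.poissonHermite_eq (h : PoissonRegular f x) {t : ℝ} (ht : 0 < t) :
    poissonHermite t f x = mixAvg (subMeasure t) f x := by
  rw [mixAvg_eq_integral (h.integrable ht), integral_subMeasure ht.le, _root_.poissonHermite_eq ht]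

/-- The derivative in `t` of the Poisson–Hermite semigroup. -/
noncomputable def poissonDeriv {d : ℕ} (t : ℝ) (f : EuclideanSpace ℝ (Fin d) → ℝ)
    (x : EuclideanSpace ℝ (Fin d)) : ℝ :=
  1 / t * (∫ r in Ioi 0, subDensity t r * ouSemigroup r f x) -
    ∫ r in Ioi 0, t / (2 * r) * subDensity t r * ouSemigroup r f x

theorem PoissonRegular.poissonDeriv_eq (h : PoissonRegular f x) {t : ℝ} (ht : 0 < t) :
    poissonDeriv t f x = 1 / t * mixAvg (subMeasure t) f x - mixAvg (subWeighted t) f x := by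
  rw [mixAvg_eq_integral (h.integrable ht), mixAvg_eq_integral (h.integrable_weighted ht),
    integral_subMeasure ht.le, integral_subWeighted ht.le, poissonDeriv]

theorem PoissonRegular.hasDerivAt (h : PoissonRegular f x) {t : ℝ} (ht : 0 < t) :
    HasDerivAt (fun s => poissonHermite s f x) (poissonDeriv t f x) t := by
  have hs : 0 < t / 4 := by positivity
  have h1 := hasDerivAt_integral_subMeasure (t := t) hs (by linarith)
    (integrable_ouSemigroup (h.integrable hs))
  refine (h1.congr_of_eventuallyEq ?_).congr_deriv ?_
  · filter_upwards [Ioi_mem_nhds ht] with q hq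
    rw [_root_.poissonHermite_eq hq, integral_subMeasure (le_of_lt hq)]
  · rw [integral_subMeasure ht.le, integral_subWeighted ht.le, poissonDeriv]

/-- The exceptional set does not depend on `t`, so derivatives in `t` and integrals over `t` agree
for the two representatives. -/
theorem PoissonRegular.congr (hf : Integrable f (gaussMeasure d)) (h : f =ᵐ[gaussMeasure d] g) :
    ∀ᵐ x ∂(gaussMeasure d), PoissonRegular f x ∧ PoissonRegular g x ∧
      ∀ t, 0 < t → poissonHermite t f x = poissonHermite t g x := by
  have h1 : ∀ᵐ x ∂(gaussMeasure d), ∀ n : ℕ,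
      f =ᵐ[mixKernel d (subMeasure (1 / ((n : ℝ) + 1))) x] g :=
    ae_all_iff.2 fun _ => ae_mixKernel_of_ae (subMeasure_nonneg _) h
  filter_upwards [h1, ae_poissonRegular hf] with x hx hr
  have hg : PoissonRegular g x := fun n => (hr n).congr (hx n)
  refine ⟨hr, hg, fun t ht => ?_⟩
  rw [hr.poissonHermite_eq ht, hg.poissonHermite_eq ht]
  obtain ⟨n, hn⟩ := exists_nat_one_div_lt ht
  refine integral_congr_ae ?_
  exact (Measure.absolutelyContinuous_of_le_smul
    (mixKernel_mono d (subMeasure_le (by positivity) hn.le) x)).ae_le (hx n)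

theorem mixAvg_subMeasure_add {t s : ℝ} (ht : 0 < t) (hs : 0 < s)
    (hf : Integrable f (gaussMeasure d)) :
    mixAvg (subMeasure t) (mixAvg (subMeasure s) f) =ᵐ[gaussMeasure d]
      mixAvg (subMeasure (t + s)) f := by
  filter_upwards [mixAvg_mixAvg (subMeasure_nonneg t) (subMeasure_nonneg s) hf] with x hx
  rw [hx]
  simp only [subMeasure_conv ht hs]

theorem poissonHermite_ae_eq {t : ℝ} (ht : 0 < t) (hf : Integrable f (gaussMeasure d)) :
    poissonHermite t f =ᵐ[gaussMeasure d] mixAvg (subMeasure t) f := by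
  filter_upwards [ae_poissonRegular hf] with x hx using hx.poissonHermite_eq ht

theorem poissonDeriv_ae_eq {t : ℝ} (ht : 0 < t) (hf : Integrable f (gaussMeasure d)) :
    poissonDeriv t f =ᵐ[gaussMeasure d]
      fun x => 1 / t * mixAvg (subMeasure t) f x - mixAvg (subWeighted t) f x := by
  filter_upwards [ae_poissonRegular hf] with x hx using hx.poissonDeriv_eq ht

theorem eLpNorm_poissonHermite_le {t : ℝ} (ht : 0 < t) {p : ℝ≥0∞} (hp : 1 ≤ p) (hpt : p ≠ ∞)
    (hf : MemLp f p (gaussMeasure d)) :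
    eLpNorm (poissonHermite t f) p (gaussMeasure d) ≤ eLpNorm f p (gaussMeasure d) := by
  rw [eLpNorm_congr_ae (poissonHermite_ae_eq ht (hf.integrable hp))]
  simpa [subMeasure_univ ht] using eLpNorm_mixAvg_le (subMeasure_nonneg t) hp hpt hf.1

theorem memLp_poissonHermite {t : ℝ} (ht : 0 < t) {p : ℝ≥0∞} (hp : 1 ≤ p) (hpt : p ≠ ∞)
    (hf : MemLp f p (gaussMeasure d)) : MemLp (poissonHermite t f) p (gaussMeasure d) :=
  (memLp_mixAvg (subMeasure_nonneg t) hp hpt hf).ae_eq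
    (poissonHermite_ae_eq ht (hf.integrable hp)).symm

theorem memLp_poissonDeriv {t : ℝ} (ht : 0 < t) {p : ℝ≥0∞} (hp : 1 ≤ p) (hpt : p ≠ ∞)
    (hf : MemLp f p (gaussMeasure d)) : MemLp (poissonDeriv t f) p (gaussMeasure d) :=
  (((memLp_mixAvg (subMeasure_nonneg t) hp hpt hf).const_mul _).sub
    (memLp_mixAvg (subWeighted_nonneg t) hp hpt hf)).ae_eq
      (poissonDeriv_ae_eq ht (hf.integrable hp)).symm

/-- The constant is `9 = 1 + 8`: mass one times `1/t`, plus the mass of `subWeighted t`, at most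
`8/t`. -/
theorem eLpNorm_poissonDeriv_le {t : ℝ} (ht : 0 < t) {p : ℝ≥0∞} (hp : 1 ≤ p) (hpt : p ≠ ∞)
    (hf : MemLp f p (gaussMeasure d)) :
    eLpNorm (poissonDeriv t f) p (gaussMeasure d) ≤
      ENNReal.ofReal (9 / t) * eLpNorm f p (gaussMeasure d) := by
  rw [eLpNorm_congr_ae (poissonDeriv_ae_eq ht (hf.integrable hp))]
  have hw : subWeighted t univ ≤ ENNReal.ofReal (8 / t) := by
    refine (subWeighted_le t univ).trans_eq ?_
    rw [Measure.smul_apply, subMeasure_univ (half_pos ht), smul_eq_mul, mul_one]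
  have h1 := (memLp_mixAvg (subMeasure_nonneg t) hp hpt hf).1.const_mul (1 / t)
  have h2 := (memLp_mixAvg (subWeighted_nonneg t) hp hpt hf).1
  refine (eLpNorm_sub_le h1 h2 hp).trans ?_
  have e : (9 / t) = 1 / t + 8 / t := by ring
  rw [e, ENNReal.ofReal_add (by positivity) (by positivity), add_mul]
  refine add_le_add ?_ ?_
  · have := eLpNorm_const_smul (1 / t) (mixAvg (subMeasure t) f) p (gaussMeasure d)
    rw [Real.enorm_of_nonneg (by positivity)] at this
    refine this.le.trans ?_
    gcongr
    simpa [subMeasure_univ ht] using eLpNorm_mixAvg_le (subMeasure_nonneg t) hp hpt hf.1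
  · refine (eLpNorm_mixAvg_le (subWeighted_nonneg t) hp hpt hf.1).trans ?_
    gcongr

theorem integrable_poissonDeriv {t : ℝ} (ht : 0 < t) (hf : Integrable f (gaussMeasure d)) :
    Integrable (poissonDeriv t f) (gaussMeasure d) := by
  rw [← memLp_one_iff_integrable] at hf ⊢
  exact memLp_poissonDeriv ht le_rfl ENNReal.one_ne_top hf

theorem integrable_poissonHermite {t : ℝ} (ht : 0 < t) (hf : Integrable f (gaussMeasure d)) :
    Integrable (poissonHermite t f) (gaussMeasure d) := by
  rw [← memLp_one_iff_integrable] at hf ⊢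
  exact memLp_poissonHermite ht le_rfl ENNReal.one_ne_top hf

theorem poissonHermite_add {t s : ℝ} (ht : 0 < t) (hs : 0 < s)
    (hf : Integrable f (gaussMeasure d)) :
    poissonHermite t (poissonHermite s f) =ᵐ[gaussMeasure d] poissonHermite (t + s) f := by
  filter_upwards [poissonHermite_ae_eq ht (integrable_poissonHermite hs hf),
    mixAvg_congr (subMeasure_nonneg t) (poissonHermite_ae_eq hs hf),
    mixAvg_subMeasure_add ht hs hf, poissonHermite_ae_eq (add_pos ht hs) hf] with x h1 h2 h3 h4
  rw [h1, h2, h3, h4]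

/-- The derivative of the semigroup commutes with the semigroup. -/
theorem poissonDeriv_poissonHermite_comm {t s : ℝ} (ht : 0 < t) (hs : 0 < s)
    (hf : Integrable f (gaussMeasure d)) :
    poissonDeriv t (poissonHermite s f) =ᵐ[gaussMeasure d]
      poissonHermite s (poissonDeriv t f) := by
  have hm := integrable_mixAvg (subMeasure_nonneg t) hf
  have hw := integrable_mixAvg (subWeighted_nonneg t) hf
  filter_upwards [poissonDeriv_ae_eq ht (integrable_poissonHermite hs hf),
    mixAvg_congr (subMeasure_nonneg t) (poissonHermite_ae_eq hs hf),
    mixAvg_congr (subWeighted_nonneg t) (poissonHermite_ae_eq hs hf),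
    mixAvg_comm (subMeasure_nonneg t) (subMeasure_nonneg s) hf,
    mixAvg_comm (subWeighted_nonneg t) (subMeasure_nonneg s) hf,
    poissonHermite_ae_eq hs (integrable_poissonDeriv ht hf),
    mixAvg_congr (subMeasure_nonneg s) (poissonDeriv_ae_eq ht hf),
    ae_integrable_mixKernel (subMeasure_nonneg s) hm,
    ae_integrable_mixKernel (subMeasure_nonneg s) hw] with x h1 h2 h3 h4 h5 h6 h7 h8 h9
  rw [h1, h2, h3, h4, h5, h6, h7]
  conv_rhs => rw [mixAvg, integral_sub (h8.const_mul _) h9, integral_const_mul]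
  rfl

/-- The law `P_t P_s f = P_{t+s} f` is differentiated in `t`. It holds almost everywhere for each
`t` separately, so it is used only along `t + 1/(n+1)`; as both sides are known to be
differentiable, one sequence determines the derivative. -/
theorem poissonDeriv_add {t s : ℝ} (ht : 0 < t) (hs : 0 < s)
    (hf : Integrable f (gaussMeasure d)) :
    poissonDeriv (t + s) f =ᵐ[gaussMeasure d] poissonDeriv t (poissonHermite s f) := by
  have h0 : ∀ᵐ x ∂(gaussMeasure d), ∀ n : ℕ,
      poissonHermite (t + 1 / ((n : ℝ) + 1)) (poissonHermite s f) x =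
        poissonHermite (t + 1 / ((n : ℝ) + 1) + s) f x :=
    ae_all_iff.2 fun n => poissonHermite_add (by positivity) hs hf
  filter_upwards [h0, poissonHermite_add ht hs hf, ae_poissonRegular hf,
    ae_poissonRegular (integrable_poissonHermite hs hf)] with x hn h1 h2 h3
  have hF := h3.hasDerivAt ht
  have hG := (h2.hasDerivAt (add_pos ht hs)).comp_add_const t s
  have hlim := (hF.sub hG).tendsto_slope
  have hseq : Tendsto (fun n : ℕ => t + 1 / ((n : ℝ) + 1)) atTop (𝓝[≠] t) := by
    refine tendsto_nhdsWithin_iff.2 ⟨?_, Eventually.of_forall fun n => ?_⟩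
    · simpa using (tendsto_one_div_add_atTop_nhds_zero_nat (𝕜 := ℝ)).const_add t
    · have : (0 : ℝ) < 1 / ((n : ℝ) + 1) := by positivity
      simp only [mem_compl_iff, mem_singleton_iff]
      linarith
  have h4 := tendsto_nhds_unique (hlim.comp hseq)
    (tendsto_const_nhds (x := (0 : ℝ)) |>.congr fun n => by
      simp only [Function.comp, slope_def_field, Pi.sub_apply, hn n, h1, sub_self, zero_div])
  linarith

end Poisson

/-! ### Minkowski's integral inequality. -/

section Minkowski

variable {X S : Type*} [MeasurableSpace X] [MeasurableSpace S] {μ : Measure X} {ν : Measure S}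

/-- Minkowski's integral inequality, for truncations. -/
theorem lintegral_min_rpow_le [IsFiniteMeasure μ] [SFinite ν] {F : X → S → ℝ≥0∞}
    (hF : Measurable (Function.uncurry F)) {p q : ℝ} (hpq : p.HolderConjugate q) (n : ℕ) :
    (∫⁻ x, (min (∫⁻ s, F x s ∂ν) n) ^ p ∂μ) ^ (1 / p) ≤
      ∫⁻ s, (∫⁻ x, F x s ^ p ∂μ) ^ (1 / p) ∂ν := by
  have hp := hpq.pos
  have hp1 := hpq.lt
  have hG : Measurable fun x => ∫⁻ s, F x s ∂ν := hF.lintegral_prod_right'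
  set g : X → ℝ≥0∞ := fun x => min (∫⁻ s, F x s ∂ν) n
  have hg : Measurable g := hG.min measurable_const
  set I := ∫⁻ x, g x ^ p ∂μ
  set N := ∫⁻ s, (∫⁻ x, F x s ^ p ∂μ) ^ (1 / p) ∂ν
  -- The truncation at `n` serves to make `I` finite, so that `I ≤ N * I ^ (1 / q)` can be divided
  -- by `I ^ (1 / q)`.
  have hI : I ≠ ∞ := by
    refine ne_of_lt (lt_of_le_of_lt (lintegral_mono (g := fun _ => (n : ℝ≥0∞) ^ p)
      fun x => ENNReal.rpow_le_rpow (min_le_right _ _) hp.le) ?_)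
    rw [lintegral_const]
    exact ENNReal.mul_lt_top (ENNReal.rpow_lt_top_of_nonneg hp.le (ENNReal.natCast_ne_top n))
      (measure_lt_top _ _)
  have hq : (p - 1) * q = p := hpq.sub_one_mul_conj
  have key : I ≤ N * I ^ (1 / q) := by
    calc I = ∫⁻ x, g x * g x ^ (p - 1) ∂μ := by
          refine lintegral_congr fun x => ?_
          nth_rewrite 2 [← ENNReal.rpow_one (g x)]
          rw [← ENNReal.rpow_add_of_nonneg _ _ zero_le_one (by linarith)]
          congr 1; ring
      _ ≤ ∫⁻ x, (∫⁻ s, F x s ∂ν) * g x ^ (p - 1) ∂μ := by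
          gcongr; exact min_le_left _ _
      _ = ∫⁻ x, ∫⁻ s, F x s * g x ^ (p - 1) ∂ν ∂μ := by
          refine lintegral_congr fun x => ?_
          rw [lintegral_mul_const _ hF.of_uncurry_left]
      _ = ∫⁻ s, ∫⁻ x, F x s * g x ^ (p - 1) ∂μ ∂ν := by
          refine lintegral_lintegral_swap (Measurable.aemeasurable ?_)
          exact hF.mul ((hg.pow_const _).comp measurable_fst)
      _ ≤ ∫⁻ s, (∫⁻ x, F x s ^ p ∂μ) ^ (1 / p) * I ^ (1 / q) ∂ν := by
          refine lintegral_mono fun s => ?_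
          refine (ENNReal.lintegral_mul_le_Lp_mul_Lq μ hpq hF.of_uncurry_right.aemeasurable
            (hg.pow_const _).aemeasurable).trans_eq ?_
          simp_rw [← ENNReal.rpow_mul, hq]
          rfl
      _ = N * I ^ (1 / q) := by
          rw [lintegral_mul_const]
          exact ((hF.pow_const p).lintegral_prod_left').pow_const _
  rcases eq_or_ne I 0 with h0 | h0
  · rw [h0, ENNReal.zero_rpow_of_pos (by positivity)]; exact zero_le
  · have h1 : I ^ (1 / p) * I ^ (1 / q) ≤ N * I ^ (1 / q) := by
      rw [← ENNReal.rpow_add _ _ h0 hI, hpq.one_div_add_one_div]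
      simpa using key
    have hq0 := hpq.symm.pos
    rwa [ENNReal.mul_le_mul_iff_left (by simp [h0, hI])
      (ENNReal.rpow_ne_top_of_nonneg (by positivity) hI)] at h1

theorem lintegral_rpow_lintegral_le [IsFiniteMeasure μ] [SFinite ν] {F : X → S → ℝ≥0∞}
    (hF : Measurable (Function.uncurry F)) {p : ℝ} (hp : 1 ≤ p) :
    (∫⁻ x, (∫⁻ s, F x s ∂ν) ^ p ∂μ) ^ (1 / p) ≤
      ∫⁻ s, (∫⁻ x, F x s ^ p ∂μ) ^ (1 / p) ∂ν := by
  rcases hp.eq_or_lt with rfl | hp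
  · simp only [ENNReal.rpow_one, div_one]
    exact (lintegral_lintegral_swap hF.aemeasurable).le
  have hpq := Real.HolderConjugate.conjExponent hp
  have hp0 := hpq.pos
  have hG : Measurable fun x => ∫⁻ s, F x s ∂ν := hF.lintegral_prod_right'
  have hlim : Tendsto (fun n : ℕ => ∫⁻ x, (min (∫⁻ s, F x s ∂ν) n) ^ p ∂μ) atTop
      (𝓝 (∫⁻ x, (∫⁻ s, F x s ∂ν) ^ p ∂μ)) := by
    refine lintegral_tendsto_of_tendsto_of_monotone
      (fun n => ((hG.min measurable_const).pow_const p).aemeasurable)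
      (ae_of_all _ fun x n m hnm => ?_) (ae_of_all _ fun x => ?_)
    · refine ENNReal.rpow_le_rpow (min_le_min_left _ ?_) hp0.le
      exact_mod_cast hnm
    · have := (tendsto_const_nhds (x := ∫⁻ s, F x s ∂ν)).min ENNReal.tendsto_nat_nhds_top
      rw [min_eq_left le_top] at this
      exact (ENNReal.continuous_rpow_const.tendsto _).comp this
  exact le_of_tendsto' ((ENNReal.continuous_rpow_const.tendsto _).comp hlim)
    fun n => lintegral_min_rpow_le hF hpq n

/-- Minkowski's integral inequality. -/
theorem eLpNorm_lintegral_le [IsFiniteMeasure μ] [SFinite ν] {w : S → ℝ≥0∞} {k : S → X → ℝ}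
    (hw : Measurable w) (hk : Measurable (Function.uncurry k)) {p : ℝ≥0∞} (hp : 1 ≤ p)
    (hpt : p ≠ ∞) :
    eLpNorm (fun x => ∫⁻ s, w s * ‖k s x‖ₑ ∂ν) p μ ≤ ∫⁻ s, w s * eLpNorm (k s) p μ ∂ν := by
  have hp0 : p ≠ 0 := (zero_lt_one.trans_le hp).ne'
  have hpr : 0 < p.toReal := ENNReal.toReal_pos hp0 hpt
  have hpr1 : 1 ≤ p.toReal := by simpa using ENNReal.toReal_mono hpt hp
  rw [eLpNorm_eq_lintegral_rpow_enorm_toReal hp0 hpt]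
  simp only [enorm_eq_self]
  refine (lintegral_rpow_lintegral_le (F := fun x s => w s * ‖k s x‖ₑ) ?_ hpr1).trans_eq ?_
  · exact (hw.comp measurable_snd).mul (hk.comp measurable_swap).enorm
  · refine lintegral_congr fun s => ?_
    rw [eLpNorm_eq_lintegral_rpow_enorm_toReal hp0 hpt]
    simp_rw [ENNReal.mul_rpow_of_nonneg _ _ hpr.le]
    rw [lintegral_const_mul _ (hk.of_uncurry_left.enorm.pow_const _),
      ENNReal.mul_rpow_of_nonneg _ _ (by positivity), ← ENNReal.rpow_mul,
      mul_one_div_cancel hpr.ne', ENNReal.rpow_one]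

end Minkowski

/-! ### Joint measurability, and the behaviour of the semigroup as `t` tends to 0. -/

section Regularity

variable {d : ℕ} {f g : EuclideanSpace ℝ (Fin d) → ℝ}

theorem measurable_ouSemigroup (hf : Measurable f) :
    Measurable fun z : ℝ × EuclideanSpace ℝ (Fin d) => ouSemigroup z.1 f z.2 := by
  have h : StronglyMeasurable fun z : (ℝ × EuclideanSpace ℝ (Fin d)) × EuclideanSpace ℝ (Fin d) =>
      f (Real.sqrt (1 - Real.exp (-2 * z.1.1)) • z.2 + Real.exp (-z.1.1) • z.1.2) :=
    Measurable.stronglyMeasurable (by fun_prop)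
  exact h.integral_prod_right'.measurable

theorem Measurable.ouSemigroup {X : Type*} [MeasurableSpace X] (hf : Measurable f) {a : X → ℝ}
    {b : X → EuclideanSpace ℝ (Fin d)} (ha : Measurable a) (hb : Measurable b) :
    Measurable fun z => ouSemigroup (a z) f (b z) := by
  have h := (measurable_ouSemigroup hf).comp (ha.prodMk hb)
  simp only [Function.comp_def] at h
  exact h

theorem measurable_poissonHermite (hf : Measurable f) :
    Measurable fun z : ℝ × EuclideanSpace ℝ (Fin d) => poissonHermite z.1 f z.2 := by
  have h1 : Measurable fun z : (ℝ × EuclideanSpace ℝ (Fin d)) × ℝ =>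
      ouSemigroup (z.1.1 ^ 2 / (4 * z.2)) f z.1.2 :=
    hf.ouSemigroup (by fun_prop) (by fun_prop)
  have h : StronglyMeasurable fun z : (ℝ × EuclideanSpace ℝ (Fin d)) × ℝ =>
      Real.exp (-z.2) / Real.sqrt z.2 * ouSemigroup (z.1.1 ^ 2 / (4 * z.2)) f z.1.2 :=
    Measurable.stronglyMeasurable (by fun_prop)
  exact (h.integral_prod_right' (ν := volume.restrict (Ioi 0))).measurable.const_mul _

theorem measurable_poissonDeriv (hf : Measurable f) :
    Measurable fun z : ℝ × EuclideanSpace ℝ (Fin d) => poissonDeriv z.1 f z.2 := by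
  have h1 : Measurable fun z : (ℝ × EuclideanSpace ℝ (Fin d)) × ℝ => ouSemigroup z.2 f z.1.2 :=
    hf.ouSemigroup (by fun_prop) (by fun_prop)
  have h2 : Measurable fun z : (ℝ × EuclideanSpace ℝ (Fin d)) × ℝ => subDensity z.1.1 z.2 :=
    measurable_subDensity.comp
      (by fun_prop : Measurable fun z : (ℝ × EuclideanSpace ℝ (Fin d)) × ℝ => (z.1.1, z.2))
  have h3 : StronglyMeasurable fun z : (ℝ × EuclideanSpace ℝ (Fin d)) × ℝ =>
      subDensity z.1.1 z.2 * ouSemigroup z.2 f z.1.2 := (h2.mul h1).stronglyMeasurable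
  have h4 : StronglyMeasurable fun z : (ℝ × EuclideanSpace ℝ (Fin d)) × ℝ =>
      z.1.1 / (2 * z.2) * subDensity z.1.1 z.2 * ouSemigroup z.2 f z.1.2 :=
    Measurable.stronglyMeasurable (by fun_prop)
  exact ((by fun_prop : Measurable fun z : ℝ × EuclideanSpace ℝ (Fin d) => 1 / z.1).mul
    (h3.integral_prod_right' (ν := volume.restrict (Ioi 0))).measurable).sub
    (h4.integral_prod_right' (ν := volume.restrict (Ioi 0))).measurable

theorem continuous_ouSemigroup (hc : Continuous f) {C : ℝ} (hC : ∀ y, ‖f y‖ ≤ C)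
    (x : EuclideanSpace ℝ (Fin d)) : Continuous fun r => ouSemigroup r f x := by
  refine continuous_of_dominated (bound := fun _ => C) (fun r => ?_)
    (fun r => ae_of_all _ fun u => hC _) (integrable_const C) (ae_of_all _ fun u => ?_)
  · exact (by fun_prop : Continuous fun u : EuclideanSpace ℝ (Fin d) =>
      f (Real.sqrt (1 - Real.exp (-2 * r)) • u + Real.exp (-r) • x)).aestronglyMeasurable
  · fun_prop

theorem norm_ouSemigroup_le {C : ℝ} (hC : ∀ y, ‖f y‖ ≤ C) (r : ℝ)
    (x : EuclideanSpace ℝ (Fin d)) : ‖ouSemigroup r f x‖ ≤ C := by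
  simpa [ouSemigroup] using norm_integral_le_of_norm_le_const (μ := gaussMeasure d)
    (f := fun u => f (Real.sqrt (1 - Real.exp (-2 * r)) • u + Real.exp (-r) • x))
    (ae_of_all _ fun u => hC _)

theorem gamma_half_integral :
    IntegrableOn (fun u => Real.exp (-u) / Real.sqrt u) (Ioi 0) ∧
      ∫ u in Ioi (0 : ℝ), Real.exp (-u) / Real.sqrt u = Real.sqrt Real.pi := by
  have e : ∀ u ∈ Ioi (0 : ℝ), Real.exp (-u) * u ^ ((1 / 2 : ℝ) - 1) =
      Real.exp (-u) / Real.sqrt u := fun u (hu : 0 < u) => by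
    rw [Real.sqrt_eq_rpow, div_eq_mul_inv (Real.exp (-u)), ← Real.rpow_neg hu.le]; norm_num
  refine ⟨(Real.GammaIntegral_convergent (s := 1 / 2) (by norm_num)).congr_fun e
    measurableSet_Ioi, ?_⟩
  rw [← Real.Gamma_one_half_eq, Real.Gamma_eq_integral (by norm_num)]
  exact (setIntegral_congr_fun measurableSet_Ioi e).symm

/-- In the original form of the subordination integral the weight is free of `t`, so dominated
convergence applies for all real `t`, including 0. -/
theorem continuous_poissonHermite (hc : Continuous f) {C : ℝ} (hC : ∀ y, ‖f y‖ ≤ C)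
    (x : EuclideanSpace ℝ (Fin d)) : Continuous fun t => poissonHermite t f x := by
  have hou := continuous_ouSemigroup hc hC x
  refine continuous_const.mul (continuous_of_dominated
    (bound := fun u => Real.exp (-u) / Real.sqrt u * C) (fun t => ?_) (fun t => ?_)
    (gamma_half_integral.1.mul_const C) (ae_of_all _ fun u => ?_))
  · have := hou.measurable
    exact Measurable.aestronglyMeasurable (by fun_prop)
  · refine ae_of_all _ fun u => ?_
    rw [norm_mul, Real.norm_of_nonneg (by positivity)]
    exact mul_le_mul_of_nonneg_left (norm_ouSemigroup_le hC _ x) (by positivity)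
  · fun_prop

theorem poissonHermite_zero (f : EuclideanSpace ℝ (Fin d) → ℝ) (x : EuclideanSpace ℝ (Fin d)) :
    poissonHermite 0 f x = f x := by
  have : ouSemigroup 0 f x = f x := by simp [ouSemigroup]
  simp only [poissonHermite, ne_eq, OfNat.ofNat_ne_zero, not_false_eq_true, zero_pow, zero_div,
    this]
  rw [integral_mul_const, gamma_half_integral.2]
  have : Real.sqrt Real.pi ≠ 0 := by positivity
  field_simp

theorem norm_poissonHermite_le {C : ℝ} (hC : ∀ y, ‖f y‖ ≤ C) (t : ℝ)
    (x : EuclideanSpace ℝ (Fin d)) : ‖poissonHermite t f x‖ ≤ C := by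
  have h : ‖∫ u in Ioi (0 : ℝ), Real.exp (-u) / Real.sqrt u * ouSemigroup (t ^ 2 / (4 * u)) f x‖ ≤
      ∫ u in Ioi (0 : ℝ), Real.exp (-u) / Real.sqrt u * C := by
    refine norm_integral_le_of_norm_le (gamma_half_integral.1.mul_const C) (ae_of_all _ fun u => ?_)
    rw [norm_mul, Real.norm_of_nonneg (by positivity)]
    exact mul_le_mul_of_nonneg_left (norm_ouSemigroup_le hC _ x) (by positivity)
  rw [integral_mul_const, gamma_half_integral.2] at h
  rw [poissonHermite, norm_mul, Real.norm_of_nonneg (by positivity), one_div_mul_eq_div]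
  exact div_le_of_le_mul₀ (by positivity) ((norm_nonneg _).trans (hC x)) (by rwa [mul_comm])

theorem tendsto_eLpNorm_poissonHermite_of_bounded (hc : Continuous f) {C : ℝ}
    (hC : ∀ y, ‖f y‖ ≤ C) :
    Tendsto (fun t => eLpNorm (poissonHermite t f - f) 1 (gaussMeasure d)) (𝓝 0) (𝓝 0) := by
  simp_rw [eLpNorm_one_eq_lintegral_enorm]
  have h := tendsto_lintegral_filter_of_dominated_convergence (μ := gaussMeasure d) (l := 𝓝 (0 : ℝ))
    (F := fun t x => ‖(poissonHermite t f - f) x‖ₑ) (f := fun _ => 0)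
    (fun _ => ENNReal.ofReal (2 * C)) (Eventually.of_forall fun t => ?_)
    (Eventually.of_forall fun t => ae_of_all _ fun x => ?_) ?_ (ae_of_all _ fun x => ?_)
  · simpa using h
  · exact (((measurable_poissonHermite hc.measurable).comp measurable_prodMk_left).sub
      hc.measurable).enorm
  · rw [← ofReal_norm, Pi.sub_apply]
    refine ENNReal.ofReal_le_ofReal ((norm_sub_le _ _).trans ?_)
    linarith [norm_poissonHermite_le hC t x, hC x]
  · simpa using ENNReal.mul_ne_top ENNReal.ofNat_ne_top ENNReal.ofReal_ne_top
  · have := ((continuous_poissonHermite hc hC x).tendsto 0).sub_const (f x)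
    rw [poissonHermite_zero, sub_self] at this
    simpa using this.enorm

/-- Strong continuity of the Poisson–Hermite semigroup on `L^1(γ_d)`. -/
theorem tendsto_eLpNorm_poissonHermite_sub (hf : Integrable f (gaussMeasure d)) :
    Tendsto (fun t => eLpNorm (poissonHermite t f - f) 1 (gaussMeasure d)) (𝓝[>] 0) (𝓝 0) := by
  rw [ENNReal.tendsto_nhds_zero]
  intro ε hε
  have h3 : ε / 3 ≠ 0 := (ENNReal.div_pos hε.ne' (by norm_num)).ne'
  have hf1 : MemLp f 1 (gaussMeasure d) := memLp_one_iff_integrable.2 hf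
  obtain ⟨g, hg, hgm⟩ := hf1.exists_boundedContinuous_eLpNorm_sub_le ENNReal.one_ne_top h3
  have hgi : Integrable g (gaussMeasure d) := memLp_one_iff_integrable.1 hgm
  have hlim := (ENNReal.tendsto_nhds_zero.1 ((tendsto_eLpNorm_poissonHermite_of_bounded
    g.continuous g.norm_coe_le_norm).mono_left (nhdsWithin_le_nhds (s := Ioi 0))))
    (ε / 3) (pos_iff_ne_zero.2 h3)
  filter_upwards [hlim, self_mem_nhdsWithin] with t ht (ht0 : 0 < t)
  have hfg := hf1.sub hgm
  have e : poissonHermite t f - f =ᵐ[gaussMeasure d]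
      poissonHermite t (f - (g : EuclideanSpace ℝ (Fin d) → ℝ)) +
        (poissonHermite t g - g) - (f - (g : EuclideanSpace ℝ (Fin d) → ℝ)) := by
    filter_upwards [poissonHermite_ae_eq ht0 hf, poissonHermite_ae_eq ht0 hgi,
      poissonHermite_ae_eq ht0 (hf.sub hgi),
      ae_integrable_mixKernel (subMeasure_nonneg t) hf,
      ae_integrable_mixKernel (subMeasure_nonneg t) hgi] with x h1 h2 h3 h4 h5
    simp only [Pi.add_apply, Pi.sub_apply, h1, h2, h3]
    rw [mixAvg, mixAvg, mixAvg]
    simp only [Pi.sub_apply]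
    rw [integral_sub h4 h5]
    ring
  have hPg := memLp_poissonHermite ht0 le_rfl ENNReal.one_ne_top hgm
  have hPfg := memLp_poissonHermite ht0 le_rfl ENNReal.one_ne_top hfg
  rw [eLpNorm_congr_ae e]
  refine (eLpNorm_sub_le (hPfg.1.add (hPg.1.sub hgm.1)) hfg.1 le_rfl).trans ?_
  refine (add_le_add_left (eLpNorm_add_le hPfg.1 (hPg.1.sub hgm.1) le_rfl) _).trans ?_
  calc _ ≤ ε / 3 + ε / 3 + ε / 3 := add_le_add (add_le_add
        ((eLpNorm_poissonHermite_le ht0 le_rfl ENNReal.one_ne_top hfg).trans hg) ht) hg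
    _ = ε := ENNReal.add_thirds ε

theorem PoissonRegular.enorm_sub_le {x : EuclideanSpace ℝ (Fin d)} (h : PoissonRegular f x)
    (hf : Measurable f) {a b : ℝ} (ha : 0 < a) (hab : a ≤ b) :
    ‖poissonHermite b f x - poissonHermite a f x‖ₑ ≤
      ∫⁻ r in Ioc a b, ‖poissonDeriv r f x‖ₑ := by
  have hm : Measurable fun r => poissonDeriv r f x :=
    (measurable_poissonDeriv hf).comp measurable_prodMk_right
  by_cases hfin : ∫⁻ r in Ioc a b, ‖poissonDeriv r f x‖ₑ = ∞
  · rw [hfin]; exact le_top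
  have hint : IntervalIntegrable (fun r => poissonDeriv r f x) volume a b := by
    rw [intervalIntegrable_iff_integrableOn_Ioc_of_le hab]
    exact ⟨hm.aestronglyMeasurable, lt_top_iff_ne_top.2 hfin⟩
  have := intervalIntegral.integral_eq_sub_of_hasDerivAt (a := a) (b := b)
    (f := fun s => poissonHermite s f x) (fun r hr => h.hasDerivAt ?_) hint
  · rw [← this, intervalIntegral.integral_of_le hab]
    exact enorm_integral_le_lintegral_enorm _
  · rw [uIcc_of_le hab] at hr
    exact ha.trans_le hr.1

/-- The fundamental theorem of calculus on `[a, b]` with `a → 0`. Strong continuity in `L^1` gives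
`P_a f(x) → f(x)` only almost everywhere along a subsequence of `a = 1/(n+1)`; that suffices, since
the bound is uniform in `a`, and the null set is independent of `b`. -/
theorem ae_enorm_poissonHermite_sub_le (hf : Integrable f (gaussMeasure d)) (hfm : Measurable f) :
    ∀ᵐ x ∂(gaussMeasure d), ∀ b, 0 < b →
      ‖poissonHermite b f x - f x‖ₑ ≤ ∫⁻ r in Ioc 0 b, ‖poissonDeriv r f x‖ₑ := by
  have hseq : Tendsto (fun n : ℕ => 1 / ((n : ℝ) + 1)) atTop (𝓝[>] 0) :=
    tendsto_nhdsWithin_iff.2 ⟨tendsto_one_div_add_atTop_nhds_zero_nat,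
      Eventually.of_forall fun n => mem_Ioi.2 (by positivity)⟩
  have hL := (tendsto_eLpNorm_poissonHermite_sub hf).comp hseq
  have hM := tendstoInMeasure_of_tendsto_eLpNorm one_ne_zero
    (f := fun n : ℕ => poissonHermite (1 / ((n : ℝ) + 1)) f)
    (fun n => (integrable_poissonHermite (t := 1 / ((n : ℝ) + 1)) (by positivity) hf).1) hf.1 hL
  obtain ⟨ns, hns, hae⟩ := hM.exists_seq_tendsto_ae
  filter_upwards [hae, ae_poissonRegular hf] with x hx hr b hb
  have hlim := (hx.const_sub (poissonHermite b f x)).enorm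
  refine le_of_tendsto hlim ?_
  have h0 := (tendsto_nhdsWithin_iff.1 hseq).1.comp hns.tendsto_atTop
  filter_upwards [h0.eventually (Iio_mem_nhds hb)] with n hn
  have hpos : (0 : ℝ) < 1 / ((ns n : ℝ) + 1) := by positivity
  exact (hr.enorm_sub_le hfm hpos (le_of_lt hn)).trans
    (lintegral_mono_set (Ioc_subset_Ioc_left hpos.le))

end Regularity

/-! ### Power integrals and scaling on the half-line. -/

theorem lintegral_rpow_Ioc {a b : ℝ} (ha : -1 < a) (hb : 0 < b) :
    ∫⁻ t in Ioc 0 b, ENNReal.ofReal (t ^ a) = ENNReal.ofReal (b ^ (a + 1) / (a + 1)) := by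
  have hi := intervalIntegral.intervalIntegrable_rpow' (a := 0) (b := b) ha
  rw [← ofReal_integral_eq_lintegral_ofReal
    ((intervalIntegrable_iff_integrableOn_Ioc_of_le hb.le).1 hi),
    ← intervalIntegral.integral_of_le hb.le, integral_rpow (Or.inl ha),
    Real.zero_rpow (by linarith), sub_zero]
  filter_upwards [ae_restrict_mem measurableSet_Ioc] with t ht using Real.rpow_nonneg ht.1.le _

theorem lintegral_rpow_Ioi {a b : ℝ} (ha : a < -1) (hb : 0 < b) :
    ∫⁻ t in Ioi b, ENNReal.ofReal (t ^ a) = ENNReal.ofReal (-b ^ (a + 1) / (a + 1)) := by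
  rw [← ofReal_integral_eq_lintegral_ofReal (integrableOn_Ioi_rpow_of_lt ha hb),
    integral_Ioi_rpow_of_lt ha hb]
  filter_upwards [ae_restrict_mem measurableSet_Ioi] with t ht
  exact Real.rpow_nonneg (hb.trans ht).le _

/-- Scaling is a measurable embedding, so `H` may be arbitrary; measurability in `t` of the norms
`‖∂_t P_t f‖_p` is never required. -/
theorem lintegral_Ioi_comp_half (H : ℝ → ℝ≥0∞) :
    ∫⁻ t in Ioi (0 : ℝ), H (t / 2) = 2 * ∫⁻ t in Ioi (0 : ℝ), H t := by
  have h2 : (2⁻¹ : ℝ) ≠ 0 := by norm_num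
  have hemb := measurableEmbedding_mulLeft₀ h2
  have h := hemb.restrict_map volume (Ioi (0 : ℝ))
  rw [Real.map_volume_mul_left h2] at h
  have hpre : (fun t : ℝ => 2⁻¹ * t) ⁻¹' Ioi 0 = Ioi 0 := by ext t; simp
  rw [hpre] at h
  have h3 := congrArg (fun μ => ∫⁻ t, H t ∂μ) h
  simp only [Measure.restrict_smul, lintegral_smul_measure] at h3
  rw [hemb.lintegral_map] at h3
  simp_rw [div_eq_inv_mul]
  rw [← h3]
  simp

theorem besovOrder_eq_one {α : ℝ} (h1 : α < 1) : besovOrder α = 1 := by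
  rw [besovOrder, Nat.floor_eq_zero.2 h1]

/-! ### Consequences of a finite Besov seminorm, and `L^p` bounds for the Riesz integral. -/

section Estimates

variable {d : ℕ} {p q : ℝ≥0∞} {f : EuclideanSpace ℝ (Fin d) → ℝ} {α β : ℝ}

theorem poissonDerivNorm_one (hf : Integrable f (gaussMeasure d)) {t : ℝ} (ht : 0 < t) :
    poissonDerivNorm 1 p f t = eLpNorm (poissonDeriv t f) p (gaussMeasure d) := by
  refine eLpNorm_congr_ae ?_
  filter_upwards [ae_poissonRegular hf] with x hx
  rw [iteratedDeriv_one, (hx.hasDerivAt ht).deriv]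

theorem poissonDeriv_add_eq {t s : ℝ} (ht : 0 < t) (hs : 0 < s)
    (hf : Integrable f (gaussMeasure d)) :
    poissonDeriv (t + s) f =ᵐ[gaussMeasure d] poissonHermite s (poissonDeriv t f) :=
  (poissonDeriv_add ht hs hf).trans (poissonDeriv_poissonHermite_comm ht hs hf)

/-- The later derivative is `P_{t-s}` applied to the earlier one, and `P_{t-s}` is a contraction. -/
theorem eLpNorm_poissonDeriv_anti (hp : 1 ≤ p) (hpt : p ≠ ∞) (hf : MemLp f p (gaussMeasure d))
    {s t : ℝ} (hs : 0 < s) (hst : s ≤ t) :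
    eLpNorm (poissonDeriv t f) p (gaussMeasure d) ≤
      eLpNorm (poissonDeriv s f) p (gaussMeasure d) := by
  rcases hst.eq_or_lt with rfl | hst
  · exact le_rfl
  have h := poissonDeriv_add_eq hs (sub_pos.2 hst) (hf.integrable hp)
  rw [add_sub_cancel] at h
  rw [eLpNorm_congr_ae h]
  exact eLpNorm_poissonHermite_le (sub_pos.2 hst) hp hpt (memLp_poissonDeriv hs hp hpt hf)

theorem besovSeminorm_top (h1 : α < 1) (hf : Integrable f (gaussMeasure d)) :
    besovSeminorm α p ∞ f = sInf {A : ℝ≥0∞ | ∀ t : ℝ, 0 < t →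
      eLpNorm (poissonDeriv t f) p (gaussMeasure d) ≤ A * ENNReal.ofReal (t ^ (α - 1))} := by
  rw [besovSeminorm, if_pos rfl, besovOrder_eq_one h1]
  congr 1
  ext A
  refine forall₂_congr fun t ht => ?_
  rw [poissonDerivNorm_one hf ht, Nat.cast_one, neg_add_eq_sub]

theorem besovSeminorm_of_ne_top (h1 : α < 1) (hq : q ≠ ∞) (hf : Integrable f (gaussMeasure d)) :
    besovSeminorm α p q f = (∫⁻ t in Ioi (0 : ℝ), (ENNReal.ofReal (t ^ (1 - α)) *
      eLpNorm (poissonDeriv t f) p (gaussMeasure d)) ^ q.toReal * ENNReal.ofReal (1 / t)) ^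
        (1 / q.toReal) := by
  rw [besovSeminorm, if_neg hq, besovOrder_eq_one h1]
  congr 1
  refine setLIntegral_congr_fun measurableSet_Ioi fun t ht => ?_
  simp only [poissonDerivNorm_one hf ht, Nat.cast_one]

/-- The Besov seminorm controls the growth of `∂_t P_t f` pointwise in `t`. -/
theorem eLpNorm_poissonDeriv_le_besovSeminorm (h0 : 0 < α) (h1 : α < 1) (hp : 1 ≤ p) (hpt : p ≠ ∞)
    (hq : 1 ≤ q) (hf : MemLp f p (gaussMeasure d)) {s : ℝ} (hs : 0 < s) :
    eLpNorm (poissonDeriv s f) p (gaussMeasure d) ≤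
      ENNReal.ofReal (4 * s ^ (α - 1)) * besovSeminorm α p q f := by
  set N := eLpNorm (poissonDeriv s f) p (gaussMeasure d)
  have hc : 0 < s ^ (α - 1) := by positivity
  rcases eq_or_ne q ∞ with rfl | hqt
  · have hle : N / ENNReal.ofReal (s ^ (α - 1)) ≤ besovSeminorm α p ∞ f := by
      rw [besovSeminorm_top h1 (hf.integrable hp)]
      exact le_sInf fun A hA => ENNReal.div_le_of_le_mul (hA s hs)
    calc N = ENNReal.ofReal (s ^ (α - 1)) * (N / ENNReal.ofReal (s ^ (α - 1))) :=
          (ENNReal.mul_div_cancel (by simpa using hc) ENNReal.ofReal_ne_top).symm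
      _ ≤ ENNReal.ofReal (4 * s ^ (α - 1)) * besovSeminorm α p ∞ f := by
          gcongr; linarith
  · have hq0 : 0 < q.toReal := ENNReal.toReal_pos (zero_lt_one.trans_le hq).ne' hqt
    have hq1 : 1 ≤ q.toReal := by simpa using ENNReal.toReal_mono hqt hq
    -- Only `(s/2, s]` is kept in the seminorm integral. There the derivative norm is at least `N`
    -- by monotonicity, and `dt/t` has mass at least `1/2`. Since `q ≥ 1`, the root of `1/2` is at
    -- least `1/2`, and the final constant is `2 * 2^{1-α} ≤ 4`.
    set B := ENNReal.ofReal ((s / 2) ^ (1 - α)) * N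
    have hle : B * (ENNReal.ofReal (1 / 2)) ^ (1 / q.toReal) ≤ besovSeminorm α p q f := by
      rw [besovSeminorm_of_ne_top h1 hqt (hf.integrable hp)]
      have e : B * (ENNReal.ofReal (1 / 2)) ^ (1 / q.toReal) =
          (B ^ q.toReal * ENNReal.ofReal (1 / 2)) ^ (1 / q.toReal) := by
        rw [ENNReal.mul_rpow_of_nonneg _ _ (by positivity), ← ENNReal.rpow_mul,
          mul_one_div_cancel hq0.ne', ENNReal.rpow_one]
      rw [e]
      refine ENNReal.rpow_le_rpow ?_ (by positivity)
      have hsub : Ioc (s / 2) s ⊆ Ioi 0 := fun t ht => lt_trans (half_pos hs) ht.1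
      refine le_trans ?_ (lintegral_mono_set hsub)
      have hconst : B ^ q.toReal * ENNReal.ofReal (1 / 2) =
          ∫⁻ _ in Ioc (s / 2) s, B ^ q.toReal * ENNReal.ofReal (1 / s) := by
        rw [setLIntegral_const, Real.volume_Ioc, mul_assoc, ← ENNReal.ofReal_mul (by positivity)]
        congr 2
        field_simp; norm_num
      rw [hconst]
      refine setLIntegral_mono' measurableSet_Ioc fun t ht => ?_
      have ht0 : 0 < t := hsub ht
      have hs2 := half_pos hs
      refine mul_le_mul' (ENNReal.rpow_le_rpow (mul_le_mul' ?_ ?_) hq0.le) ?_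
      · exact ENNReal.ofReal_le_ofReal (Real.rpow_le_rpow hs2.le ht.1.le (by linarith))
      · exact eLpNorm_poissonDeriv_anti hp hpt hf ht0 ht.2
      · exact ENNReal.ofReal_le_ofReal (one_div_le_one_div_of_le ht0 ht.2)
    have hhalf : ENNReal.ofReal (1 / 2) ≤ (ENNReal.ofReal (1 / 2)) ^ (1 / q.toReal) := by
      nth_rewrite 1 [← ENNReal.rpow_one (ENNReal.ofReal (1 / 2))]
      refine ENNReal.rpow_le_rpow_of_exponent_ge ?_ ?_
      · rw [← ENNReal.ofReal_one]; exact ENNReal.ofReal_le_ofReal (by norm_num)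
      · rw [div_le_one hq0]; exact hq1
    have h2 : B * ENNReal.ofReal (1 / 2) ≤ besovSeminorm α p q f :=
      (mul_le_mul_right hhalf B).trans hle
    have hx : 0 < (s / 2) ^ (1 - α) := by positivity
    have e2 : 2 * (s / 2) ^ (α - 1) * ((s / 2) ^ (1 - α) * (1 / 2)) = 1 := by
      rw [show α - 1 = -(1 - α) by ring, Real.rpow_neg (by positivity)]
      field_simp
    calc N = ENNReal.ofReal (2 * (s / 2) ^ (α - 1)) * (B * ENNReal.ofReal (1 / 2)) := by
          simp only [B]
          rw [mul_right_comm, ← ENNReal.ofReal_mul hx.le, ← mul_assoc,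
            ← ENNReal.ofReal_mul (by positivity), e2, ENNReal.ofReal_one, one_mul]
      _ ≤ ENNReal.ofReal (4 * s ^ (α - 1)) * besovSeminorm α p q f := by
          refine mul_le_mul' (ENNReal.ofReal_le_ofReal ?_) h2
          rw [Real.div_rpow hs.le (by norm_num)]
          have h3 : (1 / 2 : ℝ) ≤ 2 ^ (α - 1) := by
            calc (1 / 2 : ℝ) = 2 ^ (-1 : ℝ) := by rw [Real.rpow_neg_one]; norm_num
              _ ≤ _ := Real.rpow_le_rpow_of_exponent_le (by norm_num) (by linarith)
          have h4 : s ^ (α - 1) / 2 ^ (α - 1) ≤ s ^ (α - 1) / (1 / 2) := by gcongr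
          linarith

theorem eLpNorm_poissonHermite_sub_le_lintegral (hp : 1 ≤ p) (hpt : p ≠ ∞)
    (hf : MemLp f p (gaussMeasure d)) (hfm : Measurable f) {t : ℝ} (ht : 0 < t) :
    eLpNorm (poissonHermite t f - f) p (gaussMeasure d) ≤
      ∫⁻ r in Ioc 0 t, eLpNorm (poissonDeriv r f) p (gaussMeasure d) := by
  have h := eLpNorm_lintegral_le (μ := gaussMeasure d) (ν := volume.restrict (Ioc 0 t))
    (w := fun _ => 1) (k := fun r => poissonDeriv r f) measurable_const
    (measurable_poissonDeriv hfm) hp hpt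
  simp only [one_mul] at h
  refine le_trans (eLpNorm_mono_enorm_ae ?_) h
  filter_upwards [ae_enorm_poissonHermite_sub_le (hf.integrable hp) hfm] with x hx
  simpa using hx t ht

/-- Useful for `s ≤ t`: the derivative bound `9/r ≤ 9/t` is integrated over `(t, t+s]`. For larger
`s` the cruder factor 2 from contractivity takes over. -/
theorem eLpNorm_poissonHermite_add_sub_le (hp : 1 ≤ p) (hpt : p ≠ ∞)
    (hf : MemLp f p (gaussMeasure d)) (hfm : Measurable f) {t s : ℝ} (ht : 0 < t) (hs : 0 < s) :
    eLpNorm (poissonHermite (t + s) f - poissonHermite t f) p (gaussMeasure d) ≤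
      ENNReal.ofReal (9 / t * s) * eLpNorm f p (gaussMeasure d) := by
  have h := eLpNorm_lintegral_le (μ := gaussMeasure d) (ν := volume.restrict (Ioc t (t + s)))
    (w := fun _ => 1) (k := fun r => poissonDeriv r f) measurable_const
    (measurable_poissonDeriv hfm) hp hpt
  simp only [one_mul] at h
  refine (le_trans (eLpNorm_mono_enorm_ae ?_) h).trans ?_
  · filter_upwards [ae_poissonRegular (hf.integrable hp)] with x hx
    simpa using hx.enorm_sub_le hfm ht (by linarith : t ≤ t + s)
  · calc _ ≤ ∫⁻ _ in Ioc t (t + s), ENNReal.ofReal (9 / t) * eLpNorm f p (gaussMeasure d) := by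
          refine setLIntegral_mono' measurableSet_Ioc fun r hr => ?_
          refine (eLpNorm_poissonDeriv_le (ht.trans hr.1) hp hpt hf).trans ?_
          gcongr
          exact hr.1.le
      _ = _ := by
          rw [setLIntegral_const, Real.volume_Ioc, add_sub_cancel_left,
            ENNReal.ofReal_mul (by positivity)]
          ring

theorem eLpNorm_poissonHermite_sub_le_two (hp : 1 ≤ p) (hpt : p ≠ ∞)
    (hf : MemLp f p (gaussMeasure d)) {t : ℝ} (ht : 0 < t) :
    eLpNorm (poissonHermite t f - f) p (gaussMeasure d) ≤
      ENNReal.ofReal 2 * eLpNorm f p (gaussMeasure d) := by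
  refine (eLpNorm_sub_le (memLp_poissonHermite ht hp hpt hf).1 hf.1 hp).trans ?_
  rw [ENNReal.ofReal_ofNat, two_mul]
  gcongr
  exact eLpNorm_poissonHermite_le ht hp hpt hf

theorem eLpNorm_poissonHermite_add_sub_le_two (hp : 1 ≤ p) (hpt : p ≠ ∞)
    (hf : MemLp f p (gaussMeasure d)) {t s : ℝ} (ht : 0 < t) (hs : 0 < s) :
    eLpNorm (poissonHermite (t + s) f - poissonHermite t f) p (gaussMeasure d) ≤
      ENNReal.ofReal 2 * eLpNorm f p (gaussMeasure d) := by
  refine (eLpNorm_sub_le (memLp_poissonHermite (add_pos ht hs) hp hpt hf).1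
    (memLp_poissonHermite ht hp hpt hf).1 hp).trans ?_
  rw [ENNReal.ofReal_ofNat, two_mul]
  gcongr
  · exact eLpNorm_poissonHermite_le (add_pos ht hs) hp hpt hf
  · exact eLpNorm_poissonHermite_le ht hp hpt hf

/-- The absolute Riesz integral `∫_0^∞ t^{-β-1} |P_t f(x) - f(x)| dt`. -/
noncomputable def rieszAbs {d : ℕ} (β : ℝ) (f : EuclideanSpace ℝ (Fin d) → ℝ)
    (x : EuclideanSpace ℝ (Fin d)) : ℝ≥0∞ :=
  ∫⁻ t in Ioi (0 : ℝ), ENNReal.ofReal (t ^ (-β - 1)) * ‖(poissonHermite t f - f) x‖ₑ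

theorem rieszAbs_eq (x : EuclideanSpace ℝ (Fin d)) :
    rieszAbs β f x = ∫⁻ t in Ioi (0 : ℝ), ‖rieszIntegrand β f x t‖ₑ := by
  refine setLIntegral_congr_fun measurableSet_Ioi fun t (ht : 0 < t) => ?_
  simp only [rieszIntegrand, enorm_mul, Pi.sub_apply]
  rw [Real.enorm_of_nonneg (Real.rpow_nonneg ht.le _)]

theorem measurable_poissonHermite_sub (hf : Measurable f) :
    Measurable (Function.uncurry fun t : ℝ => poissonHermite t f - f) :=
  (measurable_poissonHermite hf).sub (hf.comp measurable_snd)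

theorem measurable_rieszIntegrand (hf : Measurable f) :
    Measurable fun z : EuclideanSpace ℝ (Fin d) × ℝ => rieszIntegrand β f z.1 z.2 := by
  have h := (measurable_poissonHermite_sub hf).comp
    (measurable_swap : Measurable (Prod.swap : EuclideanSpace ℝ (Fin d) × ℝ → _))
  exact (measurable_snd.pow_const (-β - 1)).mul h

theorem measurable_rieszAbs (hf : Measurable f) : Measurable (rieszAbs (d := d) β f) := by
  have e : rieszAbs (d := d) β f =
      fun x => ∫⁻ t in Ioi (0 : ℝ), ‖rieszIntegrand β f x t‖ₑ := funext fun x => rieszAbs_eq x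
  rw [e]
  exact (measurable_rieszIntegrand hf).enorm.lintegral_prod_right'

theorem measurable_rieszDeriv (hf : Measurable f) : Measurable (rieszDeriv (d := d) β f) :=
  ((measurable_rieszIntegrand hf).stronglyMeasurable.integral_prod_right'
    (ν := volume.restrict (Ioi 0))).measurable.const_mul _

/-- Splitting the weighted integral of a function that is bounded by `A t^a` near the origin and
by `B` at infinity. -/
theorem lintegral_rpow_mul_le {G : ℝ → ℝ≥0∞} {A B : ℝ≥0∞} {a b : ℝ} (hβ : 0 < β) (hβa : β < a)
    (hb : 0 < b) (h1 : ∀ t, 0 < t → G t ≤ ENNReal.ofReal (t ^ a) * A)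
    (h2 : ∀ t, 0 < t → G t ≤ B) :
    ∫⁻ t in Ioi (0 : ℝ), ENNReal.ofReal (t ^ (-β - 1)) * G t ≤
      ENNReal.ofReal (b ^ (a - β) / (a - β)) * A + ENNReal.ofReal (b ^ (-β) / β) * B := by
  rw [← Ioc_union_Ioi_eq_Ioi hb.le]
  refine (lintegral_union_le _ _ _).trans (add_le_add ?_ ?_)
  · calc _ ≤ ∫⁻ t in Ioc 0 b, ENNReal.ofReal (t ^ (a - β - 1)) * A := by
          refine setLIntegral_mono' measurableSet_Ioc fun t ht => ?_
          refine (mul_le_mul_right (h1 t ht.1) _).trans_eq ?_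
          rw [← mul_assoc, ← ENNReal.ofReal_mul (Real.rpow_nonneg ht.1.le _),
            ← Real.rpow_add ht.1]
          ring_nf
      _ = _ := by
          rw [lintegral_mul_const _ (by fun_prop), lintegral_rpow_Ioc (by linarith) hb,
            sub_add_cancel]
  · calc _ ≤ ∫⁻ t in Ioi b, ENNReal.ofReal (t ^ (-β - 1)) * B := by
          refine setLIntegral_mono' measurableSet_Ioi fun t ht => ?_
          exact mul_le_mul_right (h2 t (hb.trans ht)) _
      _ = _ := by
          rw [lintegral_mul_const _ (by fun_prop), lintegral_rpow_Ioi (by linarith) hb,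
            sub_add_cancel, neg_div_neg_eq]

/-- Integrating `4 r^{α-1}` over `(0, t]` gives `(4/α) t^α`, which beats `t^{-β-1}` near 0 because
`β < α`. Beyond `t = 1` the bound `2‖f‖_p` suffices because `β > 0`. -/
theorem eLpNorm_rieszAbs_le (hβ : 0 < β) (hβα : β < α) (hα : α < 1) (hp : 1 ≤ p) (hpt : p ≠ ∞)
    (hq : 1 ≤ q) (hf : MemLp f p (gaussMeasure d)) (hfm : Measurable f) :
    eLpNorm (rieszAbs β f) p (gaussMeasure d) ≤
      ENNReal.ofReal (1 / (α - β)) * (ENNReal.ofReal (4 / α) * besovSeminorm α p q f) +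
        ENNReal.ofReal (1 / β) * (ENNReal.ofReal 2 * eLpNorm f p (gaussMeasure d)) := by
  have hα0 : 0 < α := hβ.trans hβα
  refine (eLpNorm_lintegral_le (ν := volume.restrict (Ioi 0))
    (w := fun t => ENNReal.ofReal (t ^ (-β - 1))) (k := fun t => poissonHermite t f - f)
    (by fun_prop) (measurable_poissonHermite_sub hfm) hp hpt).trans ?_
  have := lintegral_rpow_mul_le (G := fun t => eLpNorm (poissonHermite t f - f) p (gaussMeasure d))
    hβ hβα one_pos (A := ENNReal.ofReal (4 / α) * besovSeminorm α p q f)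
    (B := ENNReal.ofReal 2 * eLpNorm f p (gaussMeasure d)) (fun t ht => ?_)
    (fun t ht => eLpNorm_poissonHermite_sub_le_two hp hpt hf ht)
  · simpa using this
  · refine (eLpNorm_poissonHermite_sub_le_lintegral hp hpt hf hfm ht).trans ?_
    calc _ ≤ ∫⁻ r in Ioc 0 t, ENNReal.ofReal (r ^ (α - 1)) *
            (ENNReal.ofReal 4 * besovSeminorm α p q f) := by
          refine setLIntegral_mono' measurableSet_Ioc fun r hr => ?_
          refine (eLpNorm_poissonDeriv_le_besovSeminorm hα0 hα hp hpt hq hf hr.1).trans_eq ?_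
          rw [ENNReal.ofReal_mul (by norm_num)]; ring
      _ = _ := by
          rw [lintegral_mul_const _ (by fun_prop), lintegral_rpow_Ioc (by linarith) ht,
            sub_add_cancel, ← mul_assoc, ← mul_assoc,
            ← ENNReal.ofReal_mul (div_nonneg (Real.rpow_nonneg ht.le _) hα0.le),
            ← ENNReal.ofReal_mul (Real.rpow_nonneg ht.le _)]
          congr 2
          ring

theorem enorm_rieszDeriv_le (x : EuclideanSpace ℝ (Fin d)) :
    ‖rieszDeriv β f x‖ₑ ≤ ‖1 / rieszConst β‖ₑ * rieszAbs β f x := by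
  rw [rieszDeriv, enorm_mul, rieszAbs_eq]
  gcongr
  exact enorm_integral_le_lintegral_enorm _

theorem eLpNorm_rieszDeriv_le (hfm : Measurable f) (hp : 1 ≤ p) (hpt : p ≠ ∞) :
    eLpNorm (rieszDeriv β f) p (gaussMeasure d) ≤
      ‖1 / rieszConst β‖ₑ * eLpNorm (rieszAbs β f) p (gaussMeasure d) := by
  have hp0 : p ≠ 0 := (zero_lt_one.trans_le hp).ne'
  have hpr : 0 < p.toReal := ENNReal.toReal_pos hp0 hpt
  refine (eLpNorm_mono_enorm (g := fun x => ‖1 / rieszConst β‖ₑ * rieszAbs β f x)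
    fun x => by simpa using enorm_rieszDeriv_le x).trans_eq ?_
  rw [eLpNorm_eq_lintegral_rpow_enorm_toReal hp0 hpt, eLpNorm_eq_lintegral_rpow_enorm_toReal hp0 hpt]
  simp only [enorm_eq_self]
  simp_rw [ENNReal.mul_rpow_of_nonneg _ _ hpr.le]
  rw [lintegral_const_mul _ ((measurable_rieszAbs hfm).pow_const _),
    ENNReal.mul_rpow_of_nonneg _ _ (by positivity), ← ENNReal.rpow_mul,
    mul_one_div_cancel hpr.ne', ENNReal.rpow_one]

theorem integrableOn_rieszIntegrand (hfm : Measurable f) {x : EuclideanSpace ℝ (Fin d)}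
    (h : rieszAbs β f x < ∞) : IntegrableOn (rieszIntegrand β f x) (Ioi 0) := by
  refine ⟨((measurable_rieszIntegrand hfm).comp measurable_prodMk_left).aestronglyMeasurable, ?_⟩
  rw [HasFiniteIntegral, ← rieszAbs_eq]
  exact h

/-- `γ_d` is a probability measure, so `L^p` embeds in `L^1`; the `L^1` bound is what Fubini uses
afterwards. -/
theorem lintegral_rieszAbs_lt_top (hfm : Measurable f) (hp : 1 ≤ p)
    (h : eLpNorm (rieszAbs β f) p (gaussMeasure d) < ∞) :
    ∫⁻ x, rieszAbs β f x ∂(gaussMeasure d) < ∞ := by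
  have := (eLpNorm_le_eLpNorm_of_exponent_le hp
    (measurable_rieszAbs (d := d) (β := β) hfm).aestronglyMeasurable).trans_lt h
  simpa [eLpNorm_one_eq_lintegral_enorm] using this

end Estimates

/-! ### Boundedness of the Riesz derivative between Besov spaces. -/

section Boundedness

variable {d : ℕ} {p q : ℝ≥0∞} {f g : EuclideanSpace ℝ (Fin d) → ℝ} {α β : ℝ}

/-- The integrand of `∂_t P_t D^β f`, in terms of `∂_t P_t (P_s f - f)`. -/
noncomputable def poissonDerivDiff {d : ℕ} (t : ℝ) (f : EuclideanSpace ℝ (Fin d) → ℝ) (s : ℝ)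
    (x : EuclideanSpace ℝ (Fin d)) : ℝ :=
  1 / t * mixAvg (subMeasure t) (poissonHermite s f - f) x -
    mixAvg (subWeighted t) (poissonHermite s f - f) x

theorem measurable_mixAvg_poissonHermite_sub {ρ : Measure ℝ} [IsFiniteMeasure ρ]
    (hf : Measurable f) :
    Measurable (Function.uncurry fun s : ℝ => mixAvg ρ (poissonHermite s f - f)) := by
  have h : StronglyMeasurable fun z : (ℝ × EuclideanSpace ℝ (Fin d)) × EuclideanSpace ℝ (Fin d) =>
      (poissonHermite z.1.1 f - f) z.2 :=
    ((measurable_poissonHermite_sub hf).comp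
      ((measurable_fst.comp measurable_fst).prodMk measurable_snd)).stronglyMeasurable
  exact (h.integral_kernel_prod_right'
    (κ := Kernel.prodMkLeft ℝ (mixKernel d ρ))).measurable

theorem measurable_poissonDerivDiff (hf : Measurable f) (t : ℝ) :
    Measurable (Function.uncurry (poissonDerivDiff t f)) :=
  ((measurable_mixAvg_poissonHermite_sub hf).const_mul _).sub
    (measurable_mixAvg_poissonHermite_sub hf)

/-- Half of the time `t` is spent on the derivative of `f`, the other half on smoothing the
difference in `s`. The first half is measured by the Besov seminorm, the second gains the factor
`s/t`. -/
theorem poissonDerivDiff_ae_eq {t s : ℝ} (ht : 0 < t) (hs : 0 < s)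
    (hf : Integrable f (gaussMeasure d)) :
    poissonDerivDiff t f s =ᵐ[gaussMeasure d]
      poissonHermite (t / 2 + s) (poissonDeriv (t / 2) f) -
        poissonHermite (t / 2) (poissonDeriv (t / 2) f) := by
  have ht2 := half_pos ht
  have hP := integrable_poissonHermite hs hf
  have h1 := poissonDeriv_add_eq ht2 (add_pos ht2 hs) hf
  rw [← add_assoc, add_halves] at h1
  have h2 := poissonDeriv_add_eq ht2 ht2 hf
  rw [add_halves] at h2
  filter_upwards [h1, h2, poissonDeriv_add ht hs hf, poissonDeriv_ae_eq ht hP,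
    poissonDeriv_ae_eq ht hf, ae_integrable_mixKernel (subMeasure_nonneg t) hf,
    ae_integrable_mixKernel (subMeasure_nonneg t) hP,
    ae_integrable_mixKernel (subWeighted_nonneg t) hf,
    ae_integrable_mixKernel (subWeighted_nonneg t) hP] with x e1 e2 e3 e4 e5 i1 i2 i3 i4
  have hsub : ∀ (ρ : Measure ℝ) [IsFiniteMeasure ρ], Integrable f (mixKernel d ρ x) →
      Integrable (poissonHermite s f) (mixKernel d ρ x) →
      mixAvg ρ (poissonHermite s f - f) x = mixAvg ρ (poissonHermite s f) x - mixAvg ρ f x :=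
    fun ρ _ h h' => integral_sub h' h
  rw [Pi.sub_apply, ← e1, ← e2, e3, e4, e5, poissonDerivDiff, hsub _ i1 i2, hsub _ i3 i4]
  ring

theorem eLpNorm_poissonDerivDiff_le (hp : 1 ≤ p) (hpt : p ≠ ∞) (hf : MemLp f p (gaussMeasure d))
    (hfm : Measurable f) {t s : ℝ} (ht : 0 < t) (hs : 0 < s) :
    eLpNorm (poissonDerivDiff t f s) p (gaussMeasure d) ≤
      ENNReal.ofReal (18 / t * s) * eLpNorm (poissonDeriv (t / 2) f) p (gaussMeasure d) ∧
    eLpNorm (poissonDerivDiff t f s) p (gaussMeasure d) ≤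
      ENNReal.ofReal 2 * eLpNorm (poissonDeriv (t / 2) f) p (gaussMeasure d) := by
  have ht2 := half_pos ht
  have hg := memLp_poissonDeriv ht2 hp hpt hf
  rw [eLpNorm_congr_ae (poissonDerivDiff_ae_eq ht hs (hf.integrable hp))]
  refine ⟨?_, eLpNorm_poissonHermite_add_sub_le_two hp hpt hg ht2 hs⟩
  have := eLpNorm_poissonHermite_add_sub_le hp hpt hg
    ((measurable_poissonDeriv hfm).comp measurable_prodMk_left) ht2 hs
  rwa [show 9 / (t / 2) = 18 / t by field_simp; norm_num] at this

/-- Fubini at almost every `x`: by invariance of `γ_d`, integrability of `rieszAbs β f` makes its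
kernel average finite almost everywhere. -/
theorem ae_mixAvg_rieszDeriv {ρ : Measure ℝ} [IsFiniteMeasure ρ] (hρ : ∀ᵐ r ∂ρ, 0 ≤ r)
    (hfm : Measurable f) (hΦ : ∫⁻ x, rieszAbs β f x ∂(gaussMeasure d) < ∞) :
    ∀ᵐ x ∂(gaussMeasure d),
      IntegrableOn (fun s => s ^ (-β - 1) * mixAvg ρ (poissonHermite s f - f) x) (Ioi 0) ∧
      mixAvg ρ (rieszDeriv β f) x = 1 / rieszConst β *
        ∫ s in Ioi 0, s ^ (-β - 1) * mixAvg ρ (poissonHermite s f - f) x := by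
  have hbind := mixKernel_comp_gaussMeasure d hρ
  have hfin : ∫⁻ x, ∫⁻ y, rieszAbs β f y ∂(mixKernel d ρ x) ∂(gaussMeasure d) < ∞ := by
    rw [← Measure.lintegral_bind (mixKernel d ρ).measurable.aemeasurable
      (measurable_rieszAbs hfm).aemeasurable, hbind, lintegral_smul_measure, smul_eq_mul]
    exact ENNReal.mul_lt_top (measure_lt_top _ _) hΦ
  filter_upwards [ae_lt_top (measurable_rieszAbs hfm).lintegral_kernel hfin.ne] with x hx
  have hint : Integrable (fun z : EuclideanSpace ℝ (Fin d) × ℝ => rieszIntegrand β f z.1 z.2)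
      ((mixKernel d ρ x).prod (volume.restrict (Ioi 0))) := by
    refine ⟨(measurable_rieszIntegrand hfm).aestronglyMeasurable, ?_⟩
    rw [HasFiniteIntegral, lintegral_prod _ (measurable_rieszIntegrand hfm).enorm.aemeasurable]
    simp_rw [← rieszAbs_eq]
    exact hx
  have e : ∀ s, ∫ y, rieszIntegrand β f y s ∂(mixKernel d ρ x) =
      s ^ (-β - 1) * mixAvg ρ (poissonHermite s f - f) x := fun s => integral_const_mul _ _
  constructor
  · have := hint.integral_prod_right
    simp only [e] at this
    exact this
  · have := integral_integral_swap (f := fun y s => rieszIntegrand β f y s) hint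
    simp only [e] at this
    rw [← this, mixAvg, ← integral_const_mul]
    rfl

theorem enorm_poissonDeriv_rieszDeriv_le (hfm : Measurable f)
    (hΦ : ∫⁻ x, rieszAbs β f x ∂(gaussMeasure d) < ∞)
    (hD : Integrable (rieszDeriv β f) (gaussMeasure d)) {t : ℝ} (ht : 0 < t) :
    ∀ᵐ x ∂(gaussMeasure d), ‖poissonDeriv t (rieszDeriv β f) x‖ₑ ≤ ‖1 / rieszConst β‖ₑ *
      ∫⁻ s in Ioi (0 : ℝ), ENNReal.ofReal (s ^ (-β - 1)) * ‖poissonDerivDiff t f s x‖ₑ := by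
  filter_upwards [poissonDeriv_ae_eq ht hD, ae_mixAvg_rieszDeriv (subMeasure_nonneg t) hfm hΦ,
    ae_mixAvg_rieszDeriv (subWeighted_nonneg t) hfm hΦ] with x e1 e2 e3
  have : poissonDeriv t (rieszDeriv β f) x = 1 / rieszConst β *
      ∫ s in Ioi 0, s ^ (-β - 1) * poissonDerivDiff t f s x := by
    rw [e1, e2.2, e3.2, mul_left_comm, ← mul_sub, ← integral_const_mul,
      ← integral_sub (e2.1.const_mul _) e3.1]
    congr 1
    refine integral_congr_ae (ae_of_all _ fun s => ?_)
    simp only [poissonDerivDiff]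
    ring
  rw [this, enorm_mul]
  gcongr
  refine (enorm_integral_le_lintegral_enorm _).trans_eq ?_
  refine setLIntegral_congr_fun measurableSet_Ioi fun s (hs : 0 < s) => ?_
  simp only [enorm_mul]
  rw [Real.enorm_of_nonneg (Real.rpow_nonneg hs.le _)]

/-- The key estimate: `‖∂_t P_t D^β f‖_p ≤ C t^{-β} ‖(∂_t P_t f)(t/2)‖_p`. -/
theorem eLpNorm_poissonDeriv_rieszDeriv_le (hβ : 0 < β) (hβ1 : β < 1) (hp : 1 ≤ p) (hpt : p ≠ ∞)
    (hf : MemLp f p (gaussMeasure d)) (hfm : Measurable f)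
    (hΦ : ∫⁻ x, rieszAbs β f x ∂(gaussMeasure d) < ∞)
    (hD : Integrable (rieszDeriv β f) (gaussMeasure d)) {t : ℝ} (ht : 0 < t) :
    eLpNorm (poissonDeriv t (rieszDeriv β f)) p (gaussMeasure d) ≤
      ENNReal.ofReal ((|1 / rieszConst β| + 1) * (18 / (1 - β) + 2 / β) * t ^ (-β)) *
        eLpNorm (poissonDeriv (t / 2) f) p (gaussMeasure d) := by
  set N := eLpNorm (poissonDeriv (t / 2) f) p (gaussMeasure d)
  have hM : eLpNorm (poissonDeriv t (rieszDeriv β f)) p (gaussMeasure d) ≤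
      ∫⁻ s in Ioi (0 : ℝ), ‖1 / rieszConst β‖ₑ * ENNReal.ofReal (s ^ (-β - 1)) *
        eLpNorm (poissonDerivDiff t f s) p (gaussMeasure d) := by
    refine le_trans (eLpNorm_mono_enorm_ae ?_) (eLpNorm_lintegral_le
      (ν := volume.restrict (Ioi 0))
      (w := fun s => ‖1 / rieszConst β‖ₑ * ENNReal.ofReal (s ^ (-β - 1)))
      (by fun_prop) (measurable_poissonDerivDiff hfm t) hp hpt)
    filter_upwards [enorm_poissonDeriv_rieszDeriv_le hfm hΦ hD ht] with x hx
    simp only [enorm_eq_self, mul_assoc]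
    rwa [lintegral_const_mul' _ _ enorm_ne_top]
  refine hM.trans ?_
  simp only [mul_assoc]
  rw [lintegral_const_mul' _ _ enorm_ne_top]
  -- The bounds `(18/t) s` and `2` are of the same order at `s = t`; splitting there makes both
  -- pieces multiples of `t^{-β}`.
  have hsplit := lintegral_rpow_mul_le
    (G := fun s => eLpNorm (poissonDerivDiff t f s) p (gaussMeasure d)) (a := 1)
    (A := ENNReal.ofReal (18 / t) * N) (B := ENNReal.ofReal 2 * N) hβ hβ1 ht
    (fun s hs => ?_) (fun s hs => (eLpNorm_poissonDerivDiff_le hp hpt hf hfm ht hs).2)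
  · have h1β : 0 < 1 - β := by linarith
    have e : ENNReal.ofReal (t ^ (1 - β) / (1 - β)) * (ENNReal.ofReal (18 / t) * N) +
        ENNReal.ofReal (t ^ (-β) / β) * (ENNReal.ofReal 2 * N) =
        ENNReal.ofReal ((18 / (1 - β) + 2 / β) * t ^ (-β)) * N := by
      rw [← mul_assoc, ← mul_assoc, ← ENNReal.ofReal_mul (by positivity),
        ← ENNReal.ofReal_mul (by positivity), ← add_mul,
        ← ENNReal.ofReal_add (by positivity) (by positivity)]
      congr 2
      rw [show 1 - β = 1 + -β by ring, Real.rpow_add ht, Real.rpow_one]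
      field_simp
    rw [e] at hsplit
    calc _ ≤ ‖1 / rieszConst β‖ₑ * (ENNReal.ofReal ((18 / (1 - β) + 2 / β) * t ^ (-β)) * N) := by
          gcongr
      _ ≤ _ := by
          rw [← mul_assoc]
          gcongr
          rw [← ofReal_norm, ← ENNReal.ofReal_mul (norm_nonneg _), Real.norm_eq_abs]
          refine ENNReal.ofReal_le_ofReal (mul_le_mul_of_nonneg_right (by linarith) ?_)
          positivity
  · refine (eLpNorm_poissonDerivDiff_le hp hpt hf hfm ht hs).1.trans_eq ?_
    rw [Real.rpow_one, ← mul_assoc, ← ENNReal.ofReal_mul hs.le, mul_comm s]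

/-- Transfer of a derivative estimate with a loss of `t^{-β}` to the Besov seminorms. -/
theorem besovSeminorm_le_of_poissonDeriv_le (hβ : 0 < β) (hβα : β < α) (hα : α < 1) (hq : 1 ≤ q)
    {h : EuclideanSpace ℝ (Fin d) → ℝ} (hf : Integrable f (gaussMeasure d))
    (hh : Integrable h (gaussMeasure d)) {K : ℝ} (hK : 0 < K)
    (hle : ∀ t, 0 < t → eLpNorm (poissonDeriv t h) p (gaussMeasure d) ≤
      ENNReal.ofReal (K * t ^ (-β)) * eLpNorm (poissonDeriv (t / 2) f) p (gaussMeasure d)) :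
    besovSeminorm (α - β) p q h ≤ ENNReal.ofReal (2 * K) * besovSeminorm α p q f := by
  -- The price of replacing `t` by `t/2` in the weight, the source of the 2 in `2 * K`.
  have hpow : ∀ t : ℝ, 0 < t → t ^ (1 - α) ≤ 2 * (t / 2) ^ (1 - α) := fun t ht => by
    rw [Real.div_rpow ht.le (by norm_num)]
    have h3 : (2 : ℝ) ^ (1 - α) ≤ 2 := by
      calc (2 : ℝ) ^ (1 - α) ≤ 2 ^ (1 : ℝ) :=
            Real.rpow_le_rpow_of_exponent_le (by norm_num) (by linarith)
        _ = 2 := Real.rpow_one 2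
    have h4 : (0 : ℝ) < 2 ^ (1 - α) := by positivity
    have h5 : 0 < t ^ (1 - α) := by positivity
    rw [mul_div_assoc', le_div_iff₀ h4, mul_comm 2]
    gcongr
  rcases eq_or_ne q ∞ with rfl | hqt
  · rw [besovSeminorm_top (by linarith) hh, besovSeminorm_top hα hf]
    have hc0 : ENNReal.ofReal (2 * K) ≠ 0 := by simpa using hK
    rw [← ENNReal.div_le_iff' hc0 ENNReal.ofReal_ne_top]
    refine le_sInf fun A hA => ?_
    rw [ENNReal.div_le_iff' hc0 ENNReal.ofReal_ne_top]
    refine sInf_le fun t ht => (hle t ht).trans ?_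
    calc _ ≤ ENNReal.ofReal (K * t ^ (-β)) * (A * ENNReal.ofReal ((t / 2) ^ (α - 1))) := by
          gcongr; exact hA _ (half_pos ht)
      _ = A * ENNReal.ofReal (K * t ^ (-β) * (t / 2) ^ (α - 1)) := by
          rw [ENNReal.ofReal_mul (p := K * t ^ (-β)) (by positivity)]; ring
      _ ≤ A * ENNReal.ofReal (2 * K * t ^ (α - β - 1)) := by
          refine mul_le_mul_right (ENNReal.ofReal_le_ofReal ?_) A
          have e1 : (t / 2) ^ (α - 1) ≤ 2 * t ^ (α - 1) := by
            rw [show α - 1 = -(1 - α) by ring, Real.rpow_neg (by positivity), Real.rpow_neg ht.le]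
            have := hpow t ht
            have h5 : 0 < t ^ (1 - α) := by positivity
            have h6 : 0 < (t / 2) ^ (1 - α) := by positivity
            rw [inv_le_iff_one_le_mul₀ h6]
            field_simp
            linarith
          calc K * t ^ (-β) * (t / 2) ^ (α - 1) ≤ K * t ^ (-β) * (2 * t ^ (α - 1)) := by gcongr
            _ = 2 * K * (t ^ (-β) * t ^ (α - 1)) := by ring
            _ = _ := by rw [← Real.rpow_add ht]; ring_nf
      _ = _ := by rw [ENNReal.ofReal_mul (by positivity)]; ring
  · have hq0 : 0 < q.toReal := ENNReal.toReal_pos (zero_lt_one.trans_le hq).ne' hqt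
    rw [besovSeminorm_of_ne_top (by linarith) hqt hh, besovSeminorm_of_ne_top hα hqt hf]
    set N := fun t => eLpNorm (poissonDeriv t f) p (gaussMeasure d)
    set H : ℝ → ℝ≥0∞ := fun t =>
      (ENNReal.ofReal (t ^ (1 - α)) * N t) ^ q.toReal * ENNReal.ofReal (1 / t)
    -- The loss `t^{-β}` turns the weight exponent `1 - (α - β)` into `1 - α`. The factor `1/2`
    -- comes from `1/t = (1/2) * (1/(t/2))` and cancels the Jacobian 2, as `dt/t` is scale
    -- invariant.
    have hHle : ∀ t, 0 < t → (ENNReal.ofReal (t ^ (1 - (α - β))) *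
        eLpNorm (poissonDeriv t h) p (gaussMeasure d)) ^ q.toReal * ENNReal.ofReal (1 / t) ≤
        ENNReal.ofReal (2 * K) ^ q.toReal * ENNReal.ofReal (1 / 2) * H (t / 2) := fun t ht => by
      have hb : ENNReal.ofReal (t ^ (1 - (α - β))) *
          eLpNorm (poissonDeriv t h) p (gaussMeasure d) ≤
          ENNReal.ofReal (2 * K) * (ENNReal.ofReal ((t / 2) ^ (1 - α)) * N (t / 2)) := by
        refine (mul_le_mul_right (hle t ht) _).trans ?_
        rw [← mul_assoc, ← mul_assoc, ← ENNReal.ofReal_mul (by positivity),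
          ← ENNReal.ofReal_mul (by positivity)]
        refine mul_le_mul_left (ENNReal.ofReal_le_ofReal ?_) _
        calc t ^ (1 - (α - β)) * (K * t ^ (-β)) = K * (t ^ (1 - (α - β)) * t ^ (-β)) := by ring
          _ = K * t ^ (1 - α) := by rw [← Real.rpow_add ht]; ring_nf
          _ ≤ K * (2 * (t / 2) ^ (1 - α)) := by gcongr; exact hpow t ht
          _ = _ := by ring
      refine (mul_le_mul_left (ENNReal.rpow_le_rpow hb hq0.le) _).trans_eq ?_
      simp only [H]
      rw [ENNReal.mul_rpow_of_nonneg _ _ hq0.le,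
        show 1 / t = 1 / 2 * (1 / (t / 2)) by field_simp,
        ENNReal.ofReal_mul (p := 1 / 2) (by norm_num)]
      ring
    calc _ ≤ (∫⁻ t in Ioi (0 : ℝ), ENNReal.ofReal (2 * K) ^ q.toReal * ENNReal.ofReal (1 / 2) *
            H (t / 2)) ^ (1 / q.toReal) := by
          refine ENNReal.rpow_le_rpow ?_ (by positivity)
          exact setLIntegral_mono' measurableSet_Ioi hHle
      _ = (ENNReal.ofReal (2 * K) ^ q.toReal * ∫⁻ t in Ioi (0 : ℝ), H t) ^ (1 / q.toReal) := by
          rw [lintegral_const_mul' _ _ (ENNReal.mul_ne_top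
            (ENNReal.rpow_ne_top_of_nonneg hq0.le ENNReal.ofReal_ne_top) ENNReal.ofReal_ne_top),
            lintegral_Ioi_comp_half, mul_assoc, ← mul_assoc (ENNReal.ofReal (1 / 2))]
          have : ENNReal.ofReal (1 / 2) * 2 = 1 := by
            rw [← ENNReal.ofReal_ofNat, ← ENNReal.ofReal_mul (by norm_num)]; norm_num
          rw [this, one_mul]
      _ = _ := by
          rw [ENNReal.mul_rpow_of_nonneg _ _ (by positivity), ← ENNReal.rpow_mul,
            mul_one_div_cancel hq0.ne', ENNReal.rpow_one]

theorem besovSeminorm_congr (hf : Integrable f (gaussMeasure d)) (h : f =ᵐ[gaussMeasure d] g) :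
    besovSeminorm α p q f = besovSeminorm α p q g := by
  have key : ∀ k t, 0 < t → poissonDerivNorm k p f t = poissonDerivNorm k p g t := fun k t ht => by
    refine eLpNorm_congr_ae ?_
    filter_upwards [PoissonRegular.congr hf h] with x hx
    refine Filter.EventuallyEq.iteratedDeriv_eq k ?_
    filter_upwards [Ioi_mem_nhds ht] with s hs using hx.2.2 s hs
  rw [besovSeminorm, besovSeminorm]
  congr 1
  · congr 1
    ext A
    exact forall₂_congr fun t ht => by rw [key _ t ht]
  · congr 1
    refine setLIntegral_congr_fun measurableSet_Ioi fun t ht => ?_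
    simp only [key _ t ht]

theorem rieszIntegrand_ae_eq (hf : Integrable f (gaussMeasure d)) (h : f =ᵐ[gaussMeasure d] g) :
    ∀ᵐ x ∂(gaussMeasure d), EqOn (rieszIntegrand β f x) (rieszIntegrand β g x) (Ioi 0) := by
  filter_upwards [PoissonRegular.congr hf h, h] with x hx hfg t ht
  rw [rieszIntegrand, rieszIntegrand, hx.2.2 t ht, hfg]

theorem ae_integrableOn_rieszIntegrand (hβ : 0 < β) (hβα : β < α) (hα : α < 1) (hp : 1 ≤ p)
    (hpt : p ≠ ∞) (hq : 1 ≤ q) (hf : MemBesov α p q f) :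
    ∀ᵐ x ∂(gaussMeasure d), IntegrableOn (rieszIntegrand β f x) (Ioi 0) := by
  obtain ⟨hfL, hfB⟩ := hf
  have hfi := hfL.integrable hp
  -- Joint measurability in `(t, x)` requires a Borel representative.
  set g := hfi.1.aemeasurable.mk f
  have hfg : f =ᵐ[gaussMeasure d] g := hfi.1.aemeasurable.ae_eq_mk
  have hgm : Measurable g := hfi.1.aemeasurable.measurable_mk
  have hgL : MemLp g p (gaussMeasure d) := hfL.ae_eq hfg
  rw [besovSeminorm_congr hfi hfg] at hfB
  have hΦ := (eLpNorm_rieszAbs_le hβ hβα hα hp hpt hq hgL hgm).trans_lt (ENNReal.add_lt_top.2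
    ⟨ENNReal.mul_lt_top ENNReal.ofReal_lt_top (ENNReal.mul_lt_top ENNReal.ofReal_lt_top hfB),
      ENNReal.mul_lt_top ENNReal.ofReal_lt_top (ENNReal.mul_lt_top ENNReal.ofReal_lt_top hgL.2)⟩)
  filter_upwards [ae_lt_top (measurable_rieszAbs hgm) (lintegral_rieszAbs_lt_top hgm hp hΦ).ne,
    rieszIntegrand_ae_eq (β := β) hfi hfg] with x hx hxe
  exact (integrableOn_rieszIntegrand hgm hx).congr_fun hxe.symm measurableSet_Ioi

theorem besovNorm_rieszDeriv_le (hβ : 0 < β) (hβα : β < α) (hα : α < 1) (hp : 1 ≤ p)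
    (hpt : p ≠ ∞) (hq : 1 ≤ q) (hf : MemBesov α p q f) :
    MemBesov (α - β) p q (rieszDeriv β f) ∧ besovNorm (α - β) p q (rieszDeriv β f) ≤
      ENNReal.ofReal ((|1 / rieszConst β| + 1) * (4 / (α * (α - β)) + 2 / β +
        2 * (18 / (1 - β) + 2 / β))) * besovNorm α p q f := by
  obtain ⟨hfL, hfB⟩ := hf
  have hα0 : 0 < α := hβ.trans hβα
  have hαβ : 0 < α - β := by linarith
  have hβ1 : 0 < 1 - β := by linarith
  have hfi := hfL.integrable hp
  set g := hfi.1.aemeasurable.mk f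
  have hfg : f =ᵐ[gaussMeasure d] g := hfi.1.aemeasurable.ae_eq_mk
  have hgm : Measurable g := hfi.1.aemeasurable.measurable_mk
  have hgL : MemLp g p (gaussMeasure d) := hfL.ae_eq hfg
  have hgi := hgL.integrable hp
  have hse : besovSeminorm α p q f = besovSeminorm α p q g := besovSeminorm_congr hfi hfg
  rw [hse] at hfB
  have hD : rieszDeriv β g =ᵐ[gaussMeasure d] rieszDeriv β f := by
    filter_upwards [rieszIntegrand_ae_eq (β := β) hfi hfg] with x hx
    rw [rieszDeriv, rieszDeriv, setIntegral_congr_fun measurableSet_Ioi hx]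
  have hΦle := eLpNorm_rieszAbs_le hβ hβα hα hp hpt hq hgL hgm
  have hΦ := hΦle.trans_lt (ENNReal.add_lt_top.2
    ⟨ENNReal.mul_lt_top ENNReal.ofReal_lt_top (ENNReal.mul_lt_top ENNReal.ofReal_lt_top hfB),
      ENNReal.mul_lt_top ENNReal.ofReal_lt_top (ENNReal.mul_lt_top ENNReal.ofReal_lt_top hgL.2)⟩)
  have hDle := eLpNorm_rieszDeriv_le (β := β) (p := p) hgm hp hpt
  have hDL : MemLp (rieszDeriv β g) p (gaussMeasure d) :=
    ⟨(measurable_rieszDeriv hgm).aestronglyMeasurable,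
      hDle.trans_lt (ENNReal.mul_lt_top enorm_lt_top hΦ)⟩
  have hDi := hDL.integrable hp
  -- Adding 1 makes the constant positive whatever the value of `rieszConst β`.
  set c := |1 / rieszConst β| + 1
  have hc0 : 0 < c := by positivity
  have hce : ‖1 / rieszConst β‖ₑ ≤ ENNReal.ofReal c := by
    rw [← ofReal_norm, Real.norm_eq_abs]
    exact ENNReal.ofReal_le_ofReal (by simp only [c]; linarith)
  have hsem := besovSeminorm_le_of_poissonDeriv_le (p := p) (q := q) hβ hβα hα hq hgi hDi
    (K := c * (18 / (1 - β) + 2 / β)) (by positivity) fun t ht =>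
      eLpNorm_poissonDeriv_rieszDeriv_le hβ (by linarith) hp hpt hgL hgm
        (lintegral_rieszAbs_lt_top hgm hp hΦ) hDi ht
  have hse' : besovSeminorm (α - β) p q (rieszDeriv β g) =
      besovSeminorm (α - β) p q (rieszDeriv β f) := besovSeminorm_congr hDi hD
  rw [hse'] at hsem
  refine ⟨⟨hDL.ae_eq hD, hsem.trans_lt (ENNReal.mul_lt_top ENNReal.ofReal_lt_top hfB)⟩, ?_⟩
  rw [besovNorm, besovNorm, ← eLpNorm_congr_ae hD, eLpNorm_congr_ae hfg, hse]
  set S := besovSeminorm α p q g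
  set L := eLpNorm g p (gaussMeasure d)
  have h1 : eLpNorm (rieszDeriv β g) p (gaussMeasure d) ≤
      ENNReal.ofReal (c * (4 / (α * (α - β)) + 2 / β)) * (L + S) := by
    refine hDle.trans ((mul_le_mul' hce hΦle).trans ?_)
    rw [← mul_assoc (ENNReal.ofReal (1 / (α - β))), ← mul_assoc (ENNReal.ofReal (1 / β)),
      ← ENNReal.ofReal_mul (by positivity), ← ENNReal.ofReal_mul (by positivity),
      ENNReal.ofReal_mul hc0.le, mul_assoc]
    gcongr
    have e1 : 1 / (α - β) * (4 / α) = 4 / (α * (α - β)) := by field_simp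
    have e2 : 1 / β * 2 = 2 / β := by field_simp
    rw [e1, e2, ENNReal.ofReal_add (by positivity) (by positivity), add_mul]
    gcongr
    · exact le_add_self
    · exact le_self_add
  calc _ ≤ ENNReal.ofReal (c * (4 / (α * (α - β)) + 2 / β)) * (L + S) +
        ENNReal.ofReal (2 * (c * (18 / (1 - β) + 2 / β))) * (L + S) := by
        refine add_le_add h1 (hsem.trans ?_)
        gcongr
        exact le_add_self
    _ = _ := by
        rw [← add_mul, ← ENNReal.ofReal_add (by positivity) (by positivity)]
        congr 2
        ring

end Boundedness

/-! ### Hermite polynomials in one variable. -/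

open Polynomial

/-- The physicists' Hermite polynomials. -/
noncomputable def physHermite : ℕ → ℝ[X]
  | 0 => 1
  | n + 1 => 2 * X * physHermite n - derivative (physHermite n)

theorem physHermite_succ (n : ℕ) :
    physHermite (n + 1) = 2 * X * physHermite n - derivative (physHermite n) := rfl

theorem derivative_physHermite_succ (n : ℕ) :
    derivative (physHermite (n + 1)) = 2 * ((n : ℝ[X]) + 1) * physHermite n := by
  induction n with
  | zero => simp [physHermite]
  | succ n ih =>
    rw [physHermite_succ (n + 1), derivative_sub, ih, derivative_mul, ih]
    have h2 : derivative (2 * X : ℝ[X]) = 2 := by simp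
    have h3 : derivative (2 * ((n : ℝ[X]) + 1) * physHermite n) =
        2 * ((n : ℝ[X]) + 1) * derivative (physHermite n) := by
      rw [derivative_mul]; simp
    rw [h2, h3]
    nth_rewrite 1 [physHermite_succ n]
    nth_rewrite 1 [physHermite_succ n]
    push_cast
    ring

theorem physHermite_add_two (n : ℕ) : physHermite (n + 2) =
    2 * X * physHermite (n + 1) - 2 * ((n : ℝ[X]) + 1) * physHermite n := by
  rw [physHermite_succ (n + 1), derivative_physHermite_succ]

theorem hasDerivAt_eval_mul_exp (P : ℝ[X]) (u : ℝ) :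
    HasDerivAt (fun u => P.eval u * Real.exp (-u ^ 2))
      ((derivative P).eval u * Real.exp (-u ^ 2) - 2 * u * P.eval u * Real.exp (-u ^ 2)) u := by
  have h : HasDerivAt (fun u : ℝ => Real.exp (-u ^ 2)) (Real.exp (-u ^ 2) * -(2 * u)) u := by
    simpa using (hasDerivAt_pow 2 u).neg.exp
  exact ((P.hasDerivAt u).mul h).congr_deriv (by ring)

theorem iteratedDeriv_exp_neg_sq (n : ℕ) : iteratedDeriv n (fun s : ℝ => Real.exp (-s ^ 2)) =
    fun x => (-1) ^ n * ((physHermite n).eval x * Real.exp (-x ^ 2)) := by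
  induction n with
  | zero => simp [physHermite]
  | succ n ih =>
    rw [iteratedDeriv_succ, ih]
    ext x
    rw [((hasDerivAt_eval_mul_exp _ x).const_mul _).deriv, physHermite_succ]
    simp only [eval_sub, eval_mul, eval_ofNat, eval_X]
    ring

theorem integrable_eval_mul_exp (P : ℝ[X]) :
    Integrable fun u : ℝ => P.eval u * Real.exp (-u ^ 2) := by
  induction P using Polynomial.induction_on' with
  | add P Q hP hQ => exact (hP.add hQ).congr (ae_of_all _ fun u => by simp [add_mul])
  | monomial n c =>
    have h := (integrable_rpow_mul_exp_neg_mul_sq one_pos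
      (s := n) (by linarith [(Nat.cast_nonneg n : (0 : ℝ) ≤ n)])).const_mul c
    simpa [mul_assoc] using h

/-- Gaussian integration by parts for polynomials. -/
theorem integral_mul_eval_mul_exp (P : ℝ[X]) :
    ∫ u : ℝ, 2 * u * P.eval u * Real.exp (-u ^ 2) =
      ∫ u : ℝ, (derivative P).eval u * Real.exp (-u ^ 2) := by
  have h1 := integrable_eval_mul_exp (derivative P)
  have h2 : Integrable fun u : ℝ => 2 * u * P.eval u * Real.exp (-u ^ 2) := by
    exact (integrable_eval_mul_exp (2 * X * P)).congr
      (ae_of_all _ fun u => by simp only [eval_mul, eval_ofNat, eval_X])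
  have := integral_eq_zero_of_hasDerivAt_of_integrable (hasDerivAt_eval_mul_exp P)
    (h1.sub h2) (integrable_eval_mul_exp P)
  rw [integral_sub h1 h2] at this
  linarith

theorem integral_exp_neg_sq : ∫ u : ℝ, Real.exp (-u ^ 2) = Real.sqrt Real.pi := by
  simpa using integral_gaussian 1

/-- Mehler's formula for Hermite polynomials in one variable. -/
theorem integral_physHermite_comp {a b : ℝ} (hab : a ^ 2 + b ^ 2 = 1) (x : ℝ) (n : ℕ) :
    ∫ u : ℝ, (physHermite n).eval (a * u + b * x) * Real.exp (-u ^ 2) =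
      b ^ n * (physHermite n).eval x * Real.sqrt Real.pi := by
  set L : ℝ[X] := C a * X + C (b * x)
  have hL : ∀ (n : ℕ) (u : ℝ), (physHermite n).eval (a * u + b * x) =
      ((physHermite n).comp L).eval u := fun n u => by simp [L, eval_comp]
  simp_rw [hL]
  -- In `2(au + bx) H_n - H_n'` the term with `2au` is integrated by parts and yields `a² H_n'`;
  -- together with `-H_n'` this leaves `-b² H_n'`. As `H_n'` is a multiple of `H_{n-1}`, a
  -- three-term recursion results, matching that of `b^n H_n(x)`.
  have hstep : ∀ n : ℕ, ∫ u : ℝ, ((physHermite (n + 1)).comp L).eval u * Real.exp (-u ^ 2) =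
      2 * b * x * (∫ u : ℝ, ((physHermite n).comp L).eval u * Real.exp (-u ^ 2)) -
        b ^ 2 * ∫ u : ℝ, ((derivative (physHermite n)).comp L).eval u * Real.exp (-u ^ 2) := by
    intro n
    have i1 := integrable_eval_mul_exp ((physHermite n).comp L)
    have i2 := integrable_eval_mul_exp ((derivative (physHermite n)).comp L)
    have i3 : Integrable fun u : ℝ =>
        2 * u * ((physHermite n).comp L).eval u * Real.exp (-u ^ 2) := by
      exact (integrable_eval_mul_exp (2 * X * (physHermite n).comp L)).congr
        (ae_of_all _ fun u => by simp only [eval_mul, eval_ofNat, eval_X])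
    have hibp := integral_mul_eval_mul_exp ((physHermite n).comp L)
    have hd : derivative ((physHermite n).comp L) =
        C a * (derivative (physHermite n)).comp L := by
      rw [derivative_comp]; simp [L]
    rw [hd] at hibp
    simp only [eval_mul, eval_C, mul_assoc] at hibp
    rw [integral_const_mul a] at hibp
    have e : ∀ u : ℝ, ((physHermite (n + 1)).comp L).eval u * Real.exp (-u ^ 2) =
        a * (2 * u * ((physHermite n).comp L).eval u * Real.exp (-u ^ 2)) +
        2 * b * x * (((physHermite n).comp L).eval u * Real.exp (-u ^ 2)) -
        ((derivative (physHermite n)).comp L).eval u * Real.exp (-u ^ 2) := fun u => by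
      rw [physHermite_succ]
      simp only [eval_comp, eval_sub, eval_mul, eval_ofNat, eval_X, L, eval_add, eval_C]
      ring
    simp_rw [e]
    have i4 : Integrable fun u : ℝ =>
        a * (2 * u * ((physHermite n).comp L).eval u * Real.exp (-u ^ 2)) +
        2 * b * x * (((physHermite n).comp L).eval u * Real.exp (-u ^ 2)) :=
      (i3.const_mul a).add (i1.const_mul (2 * b * x))
    rw [integral_sub i4 i2,
      integral_add (i3.const_mul _) (i1.const_mul _), integral_const_mul, integral_const_mul]
    simp only [mul_assoc] at hibp ⊢
    rw [hibp]
    have hb : b ^ 2 = 1 - a ^ 2 := by linarith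
    rw [hb]
    ring
  induction n using Nat.twoStepInduction with
  | zero => simp [physHermite, integral_exp_neg_sq]
  | one =>
    have := hstep 0
    simp only [zero_add] at this
    rw [this]
    simp only [physHermite, derivative_one, one_comp, zero_comp, eval_one, eval_zero, one_mul,
      zero_mul, integral_exp_neg_sq, integral_zero, mul_zero, sub_zero, mul_one, eval_mul,
      eval_ofNat, eval_X, pow_one]
    ring
  | more n ih1 ih2 =>
    have h : ∀ u : ℝ, ((derivative (physHermite (n + 1))).comp L).eval u * Real.exp (-u ^ 2) =
        2 * ((n : ℝ) + 1) * (((physHermite n).comp L).eval u * Real.exp (-u ^ 2)) := fun u => by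
      rw [derivative_physHermite_succ]
      simp only [eval_comp, eval_mul, eval_ofNat, eval_add, eval_natCast, eval_one]
      ring
    rw [hstep (n + 1), ih2]
    simp_rw [h]
    rw [integral_const_mul, ih1, physHermite_add_two]
    simp only [eval_sub, eval_mul, eval_ofNat, eval_X, eval_add, eval_natCast, eval_one]
    ring

/-! ### Spectral action on Hermite polynomials in several variables. -/

section Polynomials

variable {d : ℕ}

theorem hermiteFun_eq (ν : Fin d → ℕ) (x : EuclideanSpace ℝ (Fin d)) :
    hermiteFun ν x = 1 / Real.sqrt ((2 : ℝ) ^ (∑ i, ν i) * ((∏ i, (ν i)! : ℕ) : ℝ)) *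
      ∏ i, (physHermite (ν i)).eval (x i) := by
  rw [hermiteFun]
  congr 1
  refine Finset.prod_congr rfl fun i _ => ?_
  rw [iteratedDeriv_exp_neg_sq]
  have h1 : ((-1 : ℝ) ^ ν i) * (-1) ^ ν i = 1 := by rw [← mul_pow]; simp
  have h2 : Real.exp (x i ^ 2) * Real.exp (-(x i) ^ 2) = 1 := by rw [← Real.exp_add]; simp
  calc _ = (((-1 : ℝ) ^ ν i) * (-1) ^ ν i) * (Real.exp (x i ^ 2) * Real.exp (-(x i) ^ 2)) *
        (physHermite (ν i)).eval (x i) := by ring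
    _ = _ := by rw [h1, h2]; ring

theorem gaussDensity_eq_prod (u : EuclideanSpace ℝ (Fin d)) :
    Real.exp (-‖u‖ ^ 2) / Real.pi ^ ((d : ℝ) / 2) =
      ∏ i, (1 / Real.sqrt Real.pi * Real.exp (-(u i) ^ 2)) := by
  rw [Finset.prod_mul_distrib, ← Real.exp_sum, Finset.prod_const, Finset.card_univ,
    Fintype.card_fin, Finset.sum_neg_distrib, EuclideanSpace.real_norm_sq_eq, div_eq_mul_inv,
    mul_comm, one_div, inv_pow, Real.sqrt_eq_rpow, ← Real.rpow_natCast,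
    ← Real.rpow_mul Real.pi_pos.le]
  congr 3
  ring

theorem integral_prod_gaussMeasure (ψ : Fin d → ℝ → ℝ) :
    ∫ u, ∏ i, ψ i (u i) ∂(gaussMeasure d) =
      ∏ i, ∫ s, 1 / Real.sqrt Real.pi * Real.exp (-s ^ 2) * ψ i s := by
  rw [integral_gaussMeasure, ← integral_fintype_prod_volume_eq_prod,
    ← (PiLp.volume_preserving_toLp (Fin d)).integral_comp
      (MeasurableEquiv.toLp 2 _).measurableEmbedding]
  refine integral_congr_ae (ae_of_all _ fun u => ?_)
  simp only
  rw [gaussDensity_eq_prod, smul_eq_mul, ← Finset.prod_mul_distrib]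

theorem integrable_prod_gaussMeasure {ψ : Fin d → ℝ → ℝ}
    (h : ∀ i, Integrable fun s => 1 / Real.sqrt Real.pi * Real.exp (-s ^ 2) * ψ i s) :
    Integrable (fun u : EuclideanSpace ℝ (Fin d) => ∏ i, ψ i (u i)) (gaussMeasure d) := by
  rw [gaussMeasure, integrable_withDensity_iff_integrable_smul'
    (measurable_gaussDensity d).ennreal_ofReal (ae_of_all _ fun _ => ENNReal.ofReal_lt_top),
    ← (PiLp.volume_preserving_toLp (Fin d)).integrable_comp_emb
      (MeasurableEquiv.toLp 2 _).measurableEmbedding]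
  refine (Integrable.fintype_prod h).congr (ae_of_all _ fun u => ?_)
  simp only [Function.comp]
  rw [ENNReal.toReal_ofReal (gaussDensity_nonneg d _), gaussDensity_eq_prod, smul_eq_mul,
    ← Finset.prod_mul_distrib]

theorem integrable_hermiteFun_comp (ν : Fin d → ℕ) (a b : ℝ) (x : EuclideanSpace ℝ (Fin d)) :
    Integrable (fun u => hermiteFun ν (a • u + b • x)) (gaussMeasure d) := by
  simp_rw [hermiteFun_eq]
  refine Integrable.const_mul ?_ _
  refine integrable_prod_gaussMeasure (ψ := fun i s => (physHermite (ν i)).eval (a * s + b * x i))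
    fun i => ?_
  have h := (integrable_eval_mul_exp ((physHermite (ν i)).comp
    (C a * X + C (b * x i)))).const_mul (1 / Real.sqrt Real.pi)
  refine h.congr (ae_of_all _ fun s => ?_)
  simp only [eval_comp, eval_add, eval_mul, eval_C, eval_X]
  ring

/-- Hermite polynomials are eigenfunctions of the Ornstein–Uhlenbeck semigroup. -/
theorem ouSemigroup_hermiteFun (ν : Fin d → ℕ) {r : ℝ} (hr : 0 ≤ r)
    (x : EuclideanSpace ℝ (Fin d)) :
    ouSemigroup r (hermiteFun ν) x = Real.exp (-(((∑ i, ν i : ℕ) : ℝ) * r)) * hermiteFun ν x := by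
  have key : (ouScale r) ^ 2 + (Real.exp (-r)) ^ 2 = 1 := by
    rw [ouScale_sq hr, ← Real.exp_nat_mul]; ring_nf
  change ∫ u, hermiteFun ν (ouScale r • u + Real.exp (-r) • x) ∂(gaussMeasure d) = _
  simp_rw [hermiteFun_eq]
  rw [integral_const_mul]
  have h := integral_prod_gaussMeasure (d := d)
    fun i s => (physHermite (ν i)).eval (ouScale r * s + Real.exp (-r) * x i)
  have e : ∀ i, ∫ s : ℝ, 1 / Real.sqrt Real.pi * Real.exp (-s ^ 2) *
      (physHermite (ν i)).eval (ouScale r * s + Real.exp (-r) * x i) =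
      Real.exp (-r) ^ ν i * (physHermite (ν i)).eval (x i) := fun i => by
    have h1 := integral_physHermite_comp key (x i) (ν i)
    have h2 : Real.sqrt Real.pi ≠ 0 := by positivity
    calc _ = ∫ s : ℝ, 1 / Real.sqrt Real.pi *
          ((physHermite (ν i)).eval (ouScale r * s + Real.exp (-r) * x i) *
            Real.exp (-s ^ 2)) := by
          congr 1; ext s; ring
      _ = _ := by rw [integral_const_mul, h1]; field_simp
  simp_rw [e] at h
  rw [Finset.prod_mul_distrib, Finset.prod_pow_eq_pow_sum] at h
  simp only [PiLp.add_apply, PiLp.smul_apply, smul_eq_mul]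
  rw [h, ← Real.exp_nat_mul]
  ring_nf

theorem ouSemigroup_hermiteSum (a : (Fin d → ℕ) →₀ ℝ) {r : ℝ} (hr : 0 ≤ r)
    (x : EuclideanSpace ℝ (Fin d)) : ouSemigroup r (hermiteSum a) x =
      ∑ ν ∈ a.support, a ν * (Real.exp (-(((∑ i, ν i : ℕ) : ℝ) * r)) * hermiteFun ν x) := by
  simp only [ouSemigroup, hermiteSum, Finsupp.sum]
  rw [integral_finsetSum _ fun ν _ => (integrable_hermiteFun_comp ν _ _ x).const_mul _]
  refine Finset.sum_congr rfl fun ν _ => ?_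
  rw [integral_const_mul, ← ouSemigroup_hermiteFun ν hr]
  rfl

theorem poissonHermite_hermiteSum (a : (Fin d → ℕ) →₀ ℝ) {t : ℝ} (ht : 0 < t)
    (x : EuclideanSpace ℝ (Fin d)) : poissonHermite t (hermiteSum a) x =
      ∑ ν ∈ a.support,
        a ν * (Real.exp (-(t * Real.sqrt ((∑ i, ν i : ℕ) : ℝ))) * hermiteFun ν x) := by
  have hl : ∀ ν : Fin d → ℕ,
      IntegrableOn (fun r => subDensity t r * Real.exp (-(((∑ i, ν i : ℕ) : ℝ) * r))) (Ioi 0) ∧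
        ∫ r in Ioi (0 : ℝ), subDensity t r * Real.exp (-(((∑ i, ν i : ℕ) : ℝ) * r)) =
          Real.exp (-(t * Real.sqrt ((∑ i, ν i : ℕ) : ℝ))) := fun ν => by
    have h := laplace_subDensity ht (Real.sqrt_nonneg ((∑ i, ν i : ℕ) : ℝ))
    rwa [Real.sq_sqrt (Nat.cast_nonneg _)] at h
  rw [poissonHermite_eq ht]
  calc _ = ∫ r in Ioi 0, ∑ ν ∈ a.support, a ν * hermiteFun ν x *
        (subDensity t r * Real.exp (-(((∑ i, ν i : ℕ) : ℝ) * r))) := by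
        refine setIntegral_congr_fun measurableSet_Ioi fun r (hr : 0 < r) => ?_
        rw [ouSemigroup_hermiteSum a hr.le, Finset.mul_sum]
        exact Finset.sum_congr rfl fun ν _ => by ring
    _ = _ := by
        rw [integral_finsetSum _ fun ν _ => (hl ν).1.const_mul _]
        refine Finset.sum_congr rfl fun ν _ => ?_
        rw [integral_const_mul, (hl ν).2]
        ring

/-- Since `|e^{-u} - 1| ≤ min(u, 1)`, the integrand is dominated by `u^{-β}` near 0 and by
`u^{-β-1}` at infinity. -/
theorem integrableOn_rieszConst {β : ℝ} (hβ : 0 < β) (hβ1 : β < 1) :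
    IntegrableOn (fun u : ℝ => u ^ (-β - 1) * (Real.exp (-u) - 1)) (Ioi 0) := by
  have hm : Measurable fun u : ℝ => u ^ (-β - 1) * (Real.exp (-u) - 1) := by fun_prop
  have hle : ∀ u : ℝ, 0 < u → ‖Real.exp (-u) - 1‖ ≤ u ∧ ‖Real.exp (-u) - 1‖ ≤ 1 := fun u hu => by
    have h1 := Real.add_one_le_exp (-u)
    have h2 := Real.exp_pos (-u)
    have h3 : Real.exp (-u) < 1 := by rw [Real.exp_lt_one_iff]; linarith
    rw [Real.norm_eq_abs, abs_of_neg (by linarith)]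
    constructor <;> linarith
  rw [← Ioc_union_Ioi_eq_Ioi zero_le_one]
  refine IntegrableOn.union ?_ ?_
  · have hi := (intervalIntegrable_iff_integrableOn_Ioc_of_le zero_le_one).1
      (intervalIntegral.intervalIntegrable_rpow' (a := 0) (b := 1) (r := -β) (by linarith))
    refine Integrable.mono' hi hm.aestronglyMeasurable ?_
    filter_upwards [ae_restrict_mem measurableSet_Ioc] with u hu
    rw [norm_mul, Real.norm_of_nonneg (Real.rpow_nonneg hu.1.le _)]
    calc u ^ (-β - 1) * ‖Real.exp (-u) - 1‖ ≤ u ^ (-β - 1) * u :=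
          mul_le_mul_of_nonneg_left (hle u hu.1).1 (Real.rpow_nonneg hu.1.le _)
      _ = u ^ (-β) := by
          nth_rewrite 2 [← Real.rpow_one u]
          rw [← Real.rpow_add hu.1, sub_add_cancel]
  · refine Integrable.mono' (integrableOn_Ioi_rpow_of_lt (a := -β - 1) (by linarith) one_pos)
      hm.aestronglyMeasurable ?_
    filter_upwards [ae_restrict_mem measurableSet_Ioi] with u (hu : 1 < u)
    have hu0 : 0 < u := one_pos.trans hu
    rw [norm_mul, Real.norm_of_nonneg (Real.rpow_nonneg hu0.le _)]
    exact mul_le_of_le_one_right (Real.rpow_nonneg hu0.le _) (hle u hu0).2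

theorem rieszConst_neg {β : ℝ} (hβ : 0 < β) (hβ1 : β < 1) : rieszConst β < 0 := by
  have hneg : ∀ u : ℝ, 0 < u → 0 < -(u ^ (-β - 1) * (Real.exp (-u) - 1)) := fun u hu => by
    have h3 : Real.exp (-u) < 1 := by rw [Real.exp_lt_one_iff]; linarith
    have h4 : 0 < u ^ (-β - 1) := Real.rpow_pos_of_pos hu _
    nlinarith
  have h : 0 < ∫ u in Ioi (0 : ℝ), -(u ^ (-β - 1) * (Real.exp (-u) - 1)) := by
    rw [setIntegral_pos_iff_support_of_nonneg_ae]
    · have : Function.support (fun u : ℝ => -(u ^ (-β - 1) * (Real.exp (-u) - 1))) ∩ Ioi 0 =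
          Ioi 0 := inter_eq_right.2 fun u hu => (hneg u hu).ne'
      rw [this]
      simp
    · filter_upwards [ae_restrict_mem measurableSet_Ioi] with u hu using (hneg u hu).le
    · exact (integrableOn_rieszConst hβ hβ1).neg
  rw [integral_neg] at h
  rw [rieszConst]
  linarith

theorem integral_rpow_mul_exp_sub_one {β : ℝ} (hβ : 0 < β) (hβ1 : β < 1) {m : ℝ} (hm : 0 ≤ m) :
    IntegrableOn (fun t : ℝ => t ^ (-β - 1) * (Real.exp (-(t * m)) - 1)) (Ioi 0) ∧
      ∫ t in Ioi (0 : ℝ), t ^ (-β - 1) * (Real.exp (-(t * m)) - 1) = m ^ β * rieszConst β := by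
  rcases hm.eq_or_lt with rfl | hm
  -- The constant mode `|ν| = 0`: both sides vanish, since `0 ^ β = 0` for `β ≠ 0`. Otherwise the
  -- substitution is `u = m t`.
  · simp [Real.zero_rpow hβ.ne']
  have hi := (integrableOn_Ioi_comp_mul_left_iff _ 0 hm).2
    (by rw [mul_zero]; exact integrableOn_rieszConst hβ hβ1)
  have he := integral_comp_mul_left_Ioi
    (fun u : ℝ => u ^ (-β - 1) * (Real.exp (-u) - 1)) 0 hm
  rw [mul_zero] at he
  have e : ∀ t ∈ Ioi (0 : ℝ), m ^ (β + 1) * ((m * t) ^ (-β - 1) * (Real.exp (-(m * t)) - 1)) =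
      t ^ (-β - 1) * (Real.exp (-(t * m)) - 1) := fun t (ht : 0 < t) => by
    rw [Real.mul_rpow hm.le ht.le, ← mul_assoc, ← mul_assoc, ← Real.rpow_add hm,
      show β + 1 + (-β - 1) = 0 by ring, Real.rpow_zero, one_mul, mul_comm m t]
  refine ⟨IntegrableOn.congr_fun (hi.const_mul (m ^ (β + 1))) e measurableSet_Ioi, ?_⟩
  rw [← setIntegral_congr_fun measurableSet_Ioi e, integral_const_mul, he, smul_eq_mul,
    ← mul_assoc, Real.rpow_add hm, Real.rpow_one, mul_assoc (m ^ β), mul_inv_cancel₀ hm.ne',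
    mul_one]
  rfl

/-- On polynomials the Riesz derivative is a power of the Ornstein–Uhlenbeck operator. -/
theorem rieszDeriv_hermiteSum {β : ℝ} (hβ : 0 < β) (hβ1 : β < 1) (a : (Fin d → ℕ) →₀ ℝ)
    (x : EuclideanSpace ℝ (Fin d)) :
    IntegrableOn (rieszIntegrand β (hermiteSum a) x) (Ioi 0) ∧
      rieszDeriv β (hermiteSum a) x = spectralRiesz β a x := by
  have hk := fun ν : Fin d → ℕ =>
    integral_rpow_mul_exp_sub_one hβ hβ1 (Real.sqrt_nonneg ((∑ i, ν i : ℕ) : ℝ))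
  have e : ∀ t ∈ Ioi (0 : ℝ), ∑ ν ∈ a.support, a ν * hermiteFun ν x *
      (t ^ (-β - 1) * (Real.exp (-(t * Real.sqrt ((∑ i, ν i : ℕ) : ℝ))) - 1)) =
      rieszIntegrand β (hermiteSum a) x t := fun t (ht : 0 < t) => by
    rw [rieszIntegrand, poissonHermite_hermiteSum a ht, hermiteSum, Finsupp.sum,
      ← Finset.sum_sub_distrib, Finset.mul_sum]
    exact Finset.sum_congr rfl fun ν _ => by ring
  have hi : ∀ ν ∈ a.support, IntegrableOn (fun t : ℝ => a ν * hermiteFun ν x *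
      (t ^ (-β - 1) * (Real.exp (-(t * Real.sqrt ((∑ i, ν i : ℕ) : ℝ))) - 1))) (Ioi 0) :=
    fun ν _ => (hk ν).1.const_mul _
  refine ⟨IntegrableOn.congr_fun (integrable_finsetSum _ hi) e measurableSet_Ioi, ?_⟩
  rw [rieszDeriv, ← setIntegral_congr_fun measurableSet_Ioi e, integral_finsetSum _ hi,
    Finset.mul_sum, spectralRiesz, Finsupp.sum]
  refine Finset.sum_congr rfl fun ν _ => ?_
  -- Here `c_β` must be nonzero for the normalization to cancel; `m = √|ν|` turns `m^β` into
  -- `|ν|^{β/2}`.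
  have hc := (rieszConst_neg hβ hβ1).ne
  rw [integral_const_mul, (hk ν).2, Real.sqrt_eq_rpow, ← Real.rpow_mul (Nat.cast_nonneg _),
    one_div_mul_eq_div]
  field_simp

end Polynomials

end

theorem mainTheorem3 (d : ℕ) (α β : ℝ) (hβ : 0 < β) (hβα : β < α) (hα : α < 1)
    (p q : ℝ≥0∞) (hp : 1 ≤ p) (hp_top : p ≠ ∞) (hq : 1 ≤ q) :
    -- on polynomials the operator is the spectral power `(-L)^{β/2}`
    (∀ (a : (Fin d → ℕ) →₀ ℝ) (x : EuclideanSpace ℝ (Fin d)),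
      IntegrableOn (rieszIntegrand β (hermiteSum a) x) (Ioi 0) ∧
        rieszDeriv β (hermiteSum a) x = spectralRiesz β a x) ∧
    -- the defining integral converges absolutely almost everywhere on the Besov space
    (∀ f : EuclideanSpace ℝ (Fin d) → ℝ, MemBesov α p q f →
      ∀ᵐ x ∂(gaussMeasure d), IntegrableOn (rieszIntegrand β f x) (Ioi 0)) ∧
    -- the operator is bounded
    (∃ C : ℝ≥0, ∀ f : EuclideanSpace ℝ (Fin d) → ℝ, MemBesov α p q f →
      MemBesov (α - β) p q (rieszDeriv β f) ∧
        besovNorm (α - β) p q (rieszDeriv β f) ≤ (C : ℝ≥0∞) * besovNorm α p q f) := by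
  refine ⟨fun a x => rieszDeriv_hermiteSum hβ (hβα.trans hα) a x,
    fun f hf => ae_integrableOn_rieszIntegrand hβ hβα hα hp hp_top hq hf,
    ⟨Real.toNNReal ((|1 / rieszConst β| + 1) *
      (4 / (α * (α - β)) + 2 / β + 2 * (18 / (1 - β) + 2 / β))), fun f hf => ?_⟩⟩
  exact besovNorm_rieszDeriv_le hβ hβα hα hp hp_top hq hf
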